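/- Let $\ell=(\ell_1,\dots,\ell_n)$ be a length vector, i.e. all $\ell_i>0$. Let $$\mathcal M_d(\ell)=\{(x_1,\dots,x_n)\in (S^{d-1})^n : \textstyle\sum_i \ell_i x_i=0\}/\mathrm{SO}(d)$$ (diagonal action, quotient topology), and let $\mathcal N_d(\ell)$ be the quotient of the same space by $\mathrm O(d)$. The rank of $x=[x_1,\dots,x_n]\in\mathcal M_d(\ell)$ is the dimension of the span of $x_1,\dots,x_n$. For $m<d$ the inclusion $\mathbb R^m\times\{0\}\subset\mathbb R^d$ induces natural maps $\iota_m:\mathcal N_m(\ell)\to\mathcal M_d(\ell)$ and, for all $q$ and $r<p$, $(\mathbb R^r)^q/\mathrm O(r)\to(\mathbb R^p)^q/\mathrm{SO}(p)$. Put $a_k=\frac{k(k-1)}2+(n-k-1)(k-1)-1$. (1) Let $2\le k<d-1\le n-1$ and let $x\in\mathcal M_d(\ell)$ have rank $k$. Then there are an open neighborhood $U$ of $x$ in $\mathcal M_d(\ell)$ and a homeomorphism $$\varphi:U\to \mathbb R^{a_k}\times (\mathbb R^{d-k})^{n-1-k}/\mathrm{SO}(d-k)$$ (diagonal action) such that for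 every $m$ with $k\le m\le d-2$ there is a homeomorphism $$\psi_m:\iota_m^{-1}(U)\to\mathbb R^{a_k}\times(\mathbb R^{m-k})^{n-1-k}/\mathrm O(m-k)$$ for which $\varphi\circ\iota_m$ equals $\psi_m$ followed by the product of the identity of $\mathbb R^{a_k}$ and the natural map $(\mathbb R^{m-k})^{n-1-k}/\mathrm O(m-k)\to(\mathbb R^{d-k})^{n-1-k}/\mathrm{SO}(d-k)$. (2) Let $2\le d\le n-1$ and let $\ell$ be generic, i.e. $\sum_{j\in J}\ell_j\ne\sum_{j\notin J}\ell_j$ for all $J\subset\{1,\dots,n\}$. Then $\mathcal M_d(\ell)$ with the filtration $$\emptyset\subset\mathcal N_2(\ell)\subset\mathcal N_3(\ell)\subset\dots\subset\mathcal N_{d-2}(\ell)\subset\mathcal M_d(\ell)$$ (where $\mathcal N_k(\ell)$ stands for the image of $\iota_k$) is a topological stratified pseudomanifold in the sense of Goresky and MacPherson, of dimension $D=(n-3)(d-1)-\frac{(d-2)(d-3)}2$, where $\mathcal N_k(\ell)$ is given dimension $a_k$. That is, with $X_j=\mathcal M_d(\ell)$ for $j\ge D$ and $X_j=\bigcup_{2\le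 k\le d-2,\ a_k\le j}\mathcal N_k(\ell)$ for $j<D$: the space is paracompact Hausdorff, the $X_j$ are closed, $X_{D-1}=X_{D-2}$ has dense complement, and every point of $X_i\setminus X_{i-1}$ has an open neighborhood that is homeomorphic, preserving the filtrations, to $\mathbb R^i\times \mathrm{cone}^\circ(L)$ for a compact topological stratified pseudomanifold $L$ (defined recursively in the same way) of dimension $D-i-1$ ($L=\emptyset$ if $i=D$). -/

import Mathlib

open scoped Matrix

noncomputable section

namespace Linkage

/-- Euclidean space `ℝ^d`. -/
abbrev E (d : ℕ) : Type := EuclideanSpace ℝ (Fin d)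

/-- The action of a square matrix on `ℝ^d`. -/
def act {d : ℕ} (A : Matrix (Fin d) (Fin d) ℝ) (v : E d) : E d :=
  WithLp.toLp 2 (A *ᵥ v.ofLp)

theorem act_one {d : ℕ} (v : E d) : act 1 v = v := by
  simp [act]

theorem act_mul {d : ℕ} (A B : Matrix (Fin d) (Fin d) ℝ) (v : E d) :
    act (A * B) v = act A (act B v) := by
  simp [act, Matrix.mulVec_mulVec]

theorem act_star_act {d : ℕ} {A : Matrix (Fin d) (Fin d) ℝ}
    (hA : A ∈ Matrix.orthogonalGroup (Fin d) ℝ) (v : E d) : act (star A) (act A v) = v := by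
  rw [← act_mul, (Unitary.mem_iff.1 hA).1, act_one]

/-- Two `q`-tuples of vectors are equivalent if they lie in the same orbit of the diagonal action
of `O(d)` on `(ℝ^d)^q`. -/
def oSetoid (d q : ℕ) : Setoid (Fin q → E d) where
  r v w := ∃ A ∈ Matrix.orthogonalGroup (Fin d) ℝ, ∀ i, act A (v i) = w i
  iseqv :=
    { refl := fun v => ⟨1, one_mem _, fun i => act_one _⟩
      symm := by
        rintro v w ⟨A, hA, h⟩
        exact ⟨star A, Unitary.star_mem hA, fun i => by rw [← h i, act_star_act hA]⟩
      trans := by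
        rintro u v w ⟨A, hA, h⟩ ⟨B, hB, h'⟩
        exact ⟨B * A, mul_mem hB hA, fun i => by rw [act_mul, h i, h' i]⟩ }

/-- Two `q`-tuples of vectors are equivalent if they lie in the same orbit of the diagonal action
of `SO(d)` on `(ℝ^d)^q`. -/
def soSetoid (d q : ℕ) : Setoid (Fin q → E d) where
  r v w := ∃ A ∈ Matrix.specialOrthogonalGroup (Fin d) ℝ, ∀ i, act A (v i) = w i
  iseqv :=
    { refl := fun v => ⟨1, one_mem _, fun i => act_one _⟩
      symm := by
        rintro v w ⟨A, hA, h⟩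
        rw [Matrix.mem_specialOrthogonalGroup_iff] at hA
        refine ⟨star A, ?_, fun i => by rw [← h i, act_star_act hA.1]⟩
        rw [Matrix.mem_specialOrthogonalGroup_iff]
        refine ⟨Unitary.star_mem hA.1, ?_⟩
        rw [Matrix.star_eq_conjTranspose, Matrix.det_conjTranspose, hA.2, star_one]
      trans := by
        rintro u v w ⟨A, hA, h⟩ ⟨B, hB, h'⟩
        exact ⟨B * A, mul_mem hB hA, fun i => by rw [act_mul, h i, h' i]⟩ }

/-- The quotient space `(ℝ^p)^q / O(p)` of the diagonal action. -/
abbrev VecModO (p q : ℕ) : Type := Quotient (oSetoid p q)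

/-- The quotient space `(ℝ^p)^q / SO(p)` of the diagonal action. -/
abbrev VecModSO (p q : ℕ) : Type := Quotient (soSetoid p q)

/-- The closed configurations of the linkage with lengths `ℓ`: the unit vectors `x_1, …, x_n` in
`ℝ^d` with `∑ ℓ_i x_i = 0`. -/
abbrev Config (d : ℕ) {n : ℕ} (ℓ : Fin n → ℝ) : Type :=
  {x : Fin n → E d // (∀ i, ‖x i‖ = 1) ∧ ∑ i, ℓ i • x i = 0}

/-- The moduli space `M_d(ℓ)`: closed configurations modulo `SO(d)`, with the quotient topology. -/
abbrev ModuliM (d : ℕ) {n : ℕ} (ℓ : Fin n → ℝ) : Type :=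
  Quotient ((soSetoid d n).comap (Subtype.val : Config d ℓ → Fin n → E d))

/-- The moduli space `N_d(ℓ)`: closed configurations modulo `O(d)`, with the quotient topology. -/
abbrev ModuliN (d : ℕ) {n : ℕ} (ℓ : Fin n → ℝ) : Type :=
  Quotient ((oSetoid d n).comap (Subtype.val : Config d ℓ → Fin n → E d))

/-! ### The rank of a point -/

theorem finrank_span_le_of_act {d q : ℕ} (A : Matrix (Fin d) (Fin d) ℝ) {v w : Fin q → E d}
    (h : ∀ i, act A (v i) = w i) :
    Module.finrank ℝ (Submodule.span ℝ (Set.range w)) ≤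
      Module.finrank ℝ (Submodule.span ℝ (Set.range v)) := by
  have hw : w = Matrix.toEuclideanLin A ∘ v := by
    funext i
    rw [← h i]
    rfl
  rw [hw, Set.range_comp, Submodule.span_image]
  exact Submodule.finrank_map_le _ _

/-- The rank of a point of `M_d(ℓ)`: the dimension of the span of `x_1, …, x_n`. -/
def rank {d n : ℕ} {ℓ : Fin n → ℝ} (x : ModuliM d ℓ) : ℕ :=
  Quotient.lift
    (fun y : Config d ℓ => Module.finrank ℝ (Submodule.span ℝ (Set.range (y : Fin n → E d))))
    (by
      intro y z hyz
      have hzy : (soSetoid d n) z.1 y.1 := (soSetoid d n).symm hyz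
      obtain ⟨A, _, h⟩ := hyz
      obtain ⟨B, _, h'⟩ := hzy
      exact le_antisymm (finrank_span_le_of_act B h') (finrank_span_le_of_act A h)) x

/-! ### The natural maps from `O(m)`-quotients to `SO(d)`-quotients for `m < d` -/

/-- The standard inclusion `ℝ^m → ℝ^d` (for `m ≤ d`), appending zero coordinates. -/
def pad {m : ℕ} (d : ℕ) (v : E m) : E d :=
  WithLp.toLp 2 fun i : Fin d => if h : (i : ℕ) < m then v ⟨i, h⟩ else 0

theorem pad_zero (m d : ℕ) : pad d (0 : E m) = 0 := by
  ext i
  simp [pad]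

theorem pad_add {m : ℕ} (d : ℕ) (v w : E m) : pad d (v + w) = pad d v + pad d w := by
  ext i
  by_cases h : (i : ℕ) < m <;> simp [pad, h]

theorem pad_smul {m : ℕ} (d : ℕ) (c : ℝ) (v : E m) : pad d (c • v) = c • pad d v := by
  ext i
  by_cases h : (i : ℕ) < m <;> simp [pad, h]

theorem pad_sum_smul {m n : ℕ} (d : ℕ) (ℓ : Fin n → ℝ) (x : Fin n → E m) :
    ∑ i, ℓ i • pad d (x i) = pad d (∑ i, ℓ i • x i) := by
  let f : E m →+ E d :=
    { toFun := pad d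
      map_zero' := pad_zero m d
      map_add' := pad_add d }
  have h := map_sum f (fun i => ℓ i • x i) Finset.univ
  change pad d _ = ∑ i, pad d _ at h
  rw [h]
  exact Finset.sum_congr rfl fun i _ => (pad_smul d _ _).symm

theorem norm_pad {m d : ℕ} (hmd : m ≤ d) (v : E m) : ‖pad d v‖ = ‖v‖ := by
  obtain ⟨e, rfl⟩ := Nat.exists_eq_add_of_le hmd
  rw [EuclideanSpace.norm_eq, EuclideanSpace.norm_eq, Fin.sum_univ_add]
  simp [pad]

/-- The block matrix with blocks `A` and `diag(det A, 1, …, 1)`. -/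
def extendMatrix {m : ℕ} (e : ℕ) (A : Matrix (Fin m) (Fin m) ℝ) :
    Matrix (Fin (m + (e + 1))) (Fin (m + (e + 1))) ℝ :=
  (Matrix.fromBlocks A 0 0
    (Matrix.diagonal fun i : Fin (e + 1) => if i = 0 then A.det else 1)).submatrix
      finSumFinEquiv.symm finSumFinEquiv.symm

theorem extendMatrix_mem {m : ℕ} (e : ℕ) {A : Matrix (Fin m) (Fin m) ℝ}
    (hA : A ∈ Matrix.orthogonalGroup (Fin m) ℝ) :
    extendMatrix e A ∈ Matrix.specialOrthogonalGroup (Fin (m + (e + 1))) ℝ := by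
  have h1 : A * Aᵀ = 1 := by
    have := (Unitary.mem_iff.1 hA).2
    rwa [Matrix.star_eq_conjTranspose, Matrix.conjTranspose_eq_transpose_of_trivial] at this
  have hdet : A.det * A.det = 1 := by
    have := congrArg Matrix.det h1
    rwa [Matrix.det_mul, Matrix.det_transpose, Matrix.det_one] at this
  rw [Matrix.mem_specialOrthogonalGroup_iff]
  constructor
  · rw [Matrix.mem_orthogonalGroup_iff, extendMatrix, Matrix.transpose_submatrix,
      Matrix.submatrix_mul_equiv, Matrix.fromBlocks_transpose, Matrix.fromBlocks_multiply, h1]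
    have h2 : (Matrix.diagonal fun i : Fin (e + 1) => if i = 0 then A.det else 1) *
        (Matrix.diagonal fun i : Fin (e + 1) => if i = 0 then A.det else 1)ᵀ = 1 := by
      rw [Matrix.diagonal_transpose, Matrix.diagonal_mul_diagonal, ← Matrix.diagonal_one]
      congr 1
      funext i
      by_cases hi : i = 0 <;> simp [hi, hdet]
    rw [h2]
    simp
  · rw [extendMatrix, Matrix.det_submatrix_equiv_self, Matrix.det_fromBlocks_zero₁₂,
      Matrix.det_diagonal]
    simp [hdet]

theorem act_extendMatrix_pad {m : ℕ} (e : ℕ) (A : Matrix (Fin m) (Fin m) ℝ) (v : E m) :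
    act (extendMatrix e A) (pad (m + (e + 1)) v) = pad (m + (e + 1)) (act A v) := by
  ext i
  refine Fin.addCases (fun i => ?_) (fun i => ?_) i <;>
    simp [act, pad, extendMatrix, Matrix.mulVec, dotProduct, Fin.sum_univ_add]

/-- For `m < d`, tuples in `ℝ^m` in the same `O(m)`-orbit are in the same `SO(d)`-orbit in `ℝ^d`. -/
theorem pad_rel {m d q : ℕ} (hmd : m < d) {v w : Fin q → E m} (h : oSetoid m q v w) :
    soSetoid d q (fun i => pad d (v i)) (fun i => pad d (w i)) := by
  obtain ⟨e, rfl⟩ := Nat.exists_eq_add_of_lt hmd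
  obtain ⟨A, hA, h⟩ := h
  exact ⟨extendMatrix e A, extendMatrix_mem e hA, fun i => by
    change act (extendMatrix e A) (pad (m + (e + 1)) (v i)) = _
    rw [act_extendMatrix_pad, h i]
    rfl⟩

/-- The map `(ℝ^r)^q / O(r) → (ℝ^p)^q / SO(p)` induced by `ℝ^r ⊆ ℝ^p`, for `r < p`. -/
def vecIncl {r p : ℕ} (q : ℕ) (hrp : r < p) : VecModO r q → VecModSO p q :=
  Quotient.map (fun (v : Fin q → E r) i => pad p (v i)) fun _ _ h => pad_rel hrp h

/-- The map `N_m(ℓ) → M_d(ℓ)` induced by `ℝ^m ⊆ ℝ^d`, for `m < d`. -/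
def inclNM {m d n : ℕ} (ℓ : Fin n → ℝ) (hmd : m < d) : ModuliN m ℓ → ModuliM d ℓ :=
  Quotient.map
    (fun x : Config m ℓ =>
      (⟨fun i => pad d (x.1 i), fun i => by rw [norm_pad hmd.le, x.2.1 i], by
        rw [pad_sum_smul, x.2.2, pad_zero]⟩ : Config d ℓ))
    fun _ _ h => pad_rel hmd h

/-! ### Stratified pseudomanifolds -/

/-- The relation on `pt ⊔ L × [0,1)` that glues `L × {0}` to the point. -/
inductive ConeRel (L : Type*) : Unit ⊕ L × Set.Ico (0 : ℝ) 1 → Unit ⊕ L × Set.Ico (0 : ℝ) 1 → Prop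
  | glue (l : L) (t : Set.Ico (0 : ℝ) 1) (ht : (t : ℝ) = 0) : ConeRel L (.inr (l, t)) (.inl ())

/-- The open cone `L × [0,1) / L × {0}`, with the quotient topology; the open cone on the empty
space is a point. -/
abbrev OpenCone (L : Type*) : Type _ := Quot (ConeRel L)

/-- The vertex of the open cone. -/
def OpenCone.vertex (L : Type*) : OpenCone L := Quot.mk _ (.inl ())

/-- The open cone on `A ⊆ L`, as a subset of the open cone on `L`. -/
def OpenCone.sub {L : Type*} (A : Set L) : Set (OpenCone L) :=
  {z | z = OpenCone.vertex L ∨ ∃ l ∈ A, ∃ t, z = Quot.mk _ (.inr (l, t))}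

/-- `X` with the filtration `X_0 ⊆ X_1 ⊆ ⋯ ⊆ X_N = X` (where `X_j = F j`, and `X_j = X` for
`j ≥ N`) is a topological stratified pseudomanifold of dimension `N`, in the sense of Goresky and
MacPherson: `X` is paracompact Hausdorff, the `X_j` are closed, `X_{N-1} = X_{N-2}`, the complement
of `X_{N-2}` is dense, and each point of `X_i \ X_{i-1}` has a neighbourhood `U` which is
filtration-preservingly homeomorphic to `ℝ^i × cone(L)` for a compact stratified pseudomanifold `L`
of dimension `N - i - 1` (empty for `i = N`): `X_j ∩ U` is empty for `j < i`, it is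
`ℝ^i × vertex` for `j = i`, and `X_{i+j+1} ∩ U` is `ℝ^i × cone(L_j)` for `j ≥ 0`. -/
def IsStratifiedPseudomanifold (N : ℕ) (X : Type) [TopologicalSpace X] (F : ℕ → Set X) : Prop :=
  T2Space X ∧ ParacompactSpace X ∧
  (∀ j, IsClosed (F j)) ∧ Monotone F ∧ F N = Set.univ ∧
  (∀ j, j < N → F j ⊆ {p | ∃ j', j' + 2 ≤ N ∧ p ∈ F j'}) ∧
  Dense {p | ∃ j', j' + 2 ≤ N ∧ p ∈ F j'}ᶜ ∧
  ∀ i, i ≤ N → ∀ p ∈ F i, (∀ j, j < i → p ∉ F j) →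
    ∃ (U : Set X) (L : Type) (_ : TopologicalSpace L) (G : ℕ → Set L)
      (φ : E i × OpenCone L ≃ₜ U),
      IsOpen U ∧ p ∈ U ∧ CompactSpace L ∧
      (i = N → IsEmpty L) ∧
      (∀ _ : i < N, IsStratifiedPseudomanifold (N - i - 1) L G) ∧
      (∀ j, j < i → U ∩ F j = ∅) ∧
      (∀ z, (φ z : X) ∈ F i ↔ z.2 = OpenCone.vertex L) ∧
      (∀ j z, (φ z : X) ∈ F (i + j + 1) ↔ z.2 ∈ OpenCone.sub (G j))
termination_by N
decreasing_by omega

/-! ### Linkages -/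

/-- The length vector `ℓ` is generic: no subset `J` is median. -/
def Generic {n : ℕ} (ℓ : Fin n → ℝ) : Prop :=
  ∀ J : Finset (Fin n), ∑ j ∈ J, ℓ j ≠ ∑ j ∈ Jᶜ, ℓ j

/-- The number `k(k-1)/2 + (n-k-1)(k-1) - 1`, the dimension of the rank `k` stratum. -/
def stratumDim (n k : ℕ) : ℕ := k * (k - 1) / 2 + (n - k - 1) * (k - 1) - 1

/-- The number `(n-3)(d-1) - (d-2)(d-3)/2`, the dimension of `M_d(ℓ)`. -/
def moduliDim (n d : ℕ) : ℕ := (n - 3) * (d - 1) - (d - 2) * (d - 3) / 2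

/-- The filtration `∅ ⊆ N_2(ℓ) ⊆ N_3(ℓ) ⊆ ⋯ ⊆ N_{d-2}(ℓ) ⊆ M_d(ℓ)`, indexed by dimension: the
`j`-th term is `M_d(ℓ)` if `j ≥ dim M_d(ℓ)`, and otherwise it is the union of the `N_m(ℓ)` with
`2 ≤ m ≤ d - 2` and `stratumDim n m ≤ j`. -/
def moduliFiltration (d : ℕ) {n : ℕ} (ℓ : Fin n → ℝ) (j : ℕ) : Set (ModuliM d ℓ) :=
  {x | moduliDim n d ≤ j ∨
    ∃ (m : ℕ) (hm : m + 2 ≤ d), 2 ≤ m ∧ stratumDim n m ≤ j ∧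
      x ∈ Set.range (inclNM (d := d) ℓ (show m < d by omega))}

end Linkage

end

noncomputable section

namespace Linkage

open Topology Matrix OpenPartialHomeomorph

/-! ### The orthogonal action -/

/-! Put q = n - 1. The last vector of a closed configuration is determined by the others, so M_d(ℓ)
is the part of (ℝ^d)^q / SO(d) cut out by the n equations |y_i|² = 1 and |∑ ℓ_i y_i|² = ℓ_n²
(`moduliHomeo`). These are linear in the Gram matrix, and most of the argument treats arbitrary
`level` sets of this kind.

Local structure (`exists_chart`). Let y have rank k, reordered so that its first k vectors are
independent. Gram–Schmidt moves every orbit of tuples with this independence into a slice: the first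
k vectors form a lower triangular matrix in ℝ^k, and the other r = q - k have free components in ℝ^k
together with components w in ℝ^e, e = d - k. What remains of the group is SO(e) acting on w
(`exists_emb`, `eq_of_soSetoid_emb`). With p the triangular coordinates, the constraints split as
G(p) + H(w) = c, where H sees only the Gram matrix of w and is therefore SO(e)-invariant. If the
tuples M_c y are independent, G is a submersion at the base point, and the implicit function theorem
expresses p through w and a Euclidean parameter. This gives a chart ℝ^a × (ℝ^e)^r / SO(e) in which
the rank is k plus the rank of w. For linkages the independence holds as soon as the rank is at
least 2 (`linearIndependent_linkM`).

Part (1). The natural maps are embeddings whose images are exactly the sets of bounded rank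
(`range_inclNM`, `range_vecIncl`). A chart that shifts the rank by k therefore matches these images,
and each ψ_m is read off from two embeddings with the same range.

Part (2). Genericity excludes rank less than 2. By scaling, (ℝ^e)^r / SO(e) is the open cone on the
quotient of the unit sphere (`coneHomeo`), which is again a level set, with the single constraint ∑
|y_i|² = 1; so `isStratifiedPseudomanifold_link` follows by strong induction on e. Ranks d - 1 and d
together form the regular stratum because SO(1) and SO(0) are trivial. All dimensions come from the
entry count `bdim` of triangular matrices. -/

theorem act_eq_toEuclideanLin {d : ℕ} (A : Matrix (Fin d) (Fin d) ℝ) (v : E d) :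
    act A v = Matrix.toEuclideanLin A v := rfl

theorem act_smul {d : ℕ} (A : Matrix (Fin d) (Fin d) ℝ) (c : ℝ) (v : E d) :
    act A (c • v) = c • act A v := by
  simp [act_eq_toEuclideanLin]

theorem act_zero {d : ℕ} (A : Matrix (Fin d) (Fin d) ℝ) : act A 0 = 0 := by
  simp [act_eq_toEuclideanLin]

theorem act_sum_smul {d n : ℕ} (A : Matrix (Fin d) (Fin d) ℝ) (ℓ : Fin n → ℝ) (v : Fin n → E d) :
    act A (∑ i, ℓ i • v i) = ∑ i, ℓ i • act A (v i) := by
  simp [act_eq_toEuclideanLin, map_sum]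

theorem act_apply {d : ℕ} (A : Matrix (Fin d) (Fin d) ℝ) (v : E d) (a : Fin d) :
    act A v a = ∑ b, A a b * v b := rfl

theorem inner_eq_sum {d : ℕ} (v w : E d) : inner ℝ v w = ∑ a, v a * w a := by
  simp [PiLp.inner_apply, mul_comm]

theorem inner_act {d : ℕ} {A : Matrix (Fin d) (Fin d) ℝ}
    (hA : A ∈ Matrix.orthogonalGroup (Fin d) ℝ) (v w : E d) :
    inner ℝ (act A v) (act A w) = inner ℝ v w := by
  have h : Aᵀ * A = 1 := (Matrix.mem_orthogonalGroup_iff' _ _).1 hA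
  have key : ∀ x y : E d, inner ℝ x y = y.ofLp ⬝ᵥ x.ofLp := fun x y => by
    simp [inner_eq_sum, dotProduct, mul_comm]
  rw [key, key]
  change (A *ᵥ w.ofLp) ⬝ᵥ (A *ᵥ v.ofLp) = _
  rw [Matrix.dotProduct_mulVec, Matrix.vecMul_mulVec, h, Matrix.vecMul_one]

theorem norm_act {d : ℕ} {A : Matrix (Fin d) (Fin d) ℝ}
    (hA : A ∈ Matrix.orthogonalGroup (Fin d) ℝ) (v : E d) : ‖act A v‖ = ‖v‖ := by
  rw [@norm_eq_sqrt_real_inner _ _ _ v, @norm_eq_sqrt_real_inner _ _ _ (act A v), inner_act hA]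

theorem continuous_act {d : ℕ} :
    Continuous fun p : Matrix (Fin d) (Fin d) ℝ × E d => act p.1 p.2 := by
  unfold act
  refine (PiLp.continuous_toLp 2 _).comp ?_
  exact continuous_fst.matrix_mulVec ((PiLp.continuous_ofLp 2 _).comp continuous_snd)

theorem isCompact_specialOrthogonalGroup (d : ℕ) :
    IsCompact (Matrix.specialOrthogonalGroup (Fin d) ℝ : Set (Matrix (Fin d) (Fin d) ℝ)) := by
  have hc : IsCompact (Set.univ.pi fun _ => Set.univ.pi fun _ => Set.Icc (-1) 1 :
      Set (Fin d → Fin d → ℝ)) :=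
    isCompact_univ_pi fun _ => isCompact_univ_pi fun _ => isCompact_Icc
  refine hc.of_isClosed_subset (X := Fin d → Fin d → ℝ) ?_ ?_
  · have : (Matrix.specialOrthogonalGroup (Fin d) ℝ : Set (Matrix (Fin d) (Fin d) ℝ)) =
        {A | A * Aᵀ = 1} ∩ {A | A.det = 1} := by
      ext A
      simp only [SetLike.mem_coe, Matrix.mem_specialOrthogonalGroup_iff, Matrix.mem_orthogonalGroup_iff]
      rfl
    change IsClosed (Matrix.specialOrthogonalGroup (Fin d) ℝ : Set (Matrix (Fin d) (Fin d) ℝ))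
    rw [this]
    exact (isClosed_eq (continuous_id.matrix_mul continuous_id.matrix_transpose)
      continuous_const).inter (isClosed_eq continuous_id.matrix_det continuous_const)
  · intro A hA i _ j _
    have := entry_norm_bound_of_unitary (𝕜 := ℝ) (Matrix.mem_specialOrthogonalGroup_iff.1 hA).1 i j
    rwa [Real.norm_eq_abs, abs_le] at this

theorem continuous_act_tuple {d q : ℕ} (A : Matrix (Fin d) (Fin d) ℝ) :
    Continuous fun (v : Fin q → E d) i => act A (v i) :=
  continuous_pi fun i => continuous_act.comp (by fun_prop : Continuous fun v : Fin q → E d => (A, v i))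

/-- The saturation of an open set is a union of translates. Openness is what lets the quotient map
be multiplied by a further factor, as is done for scaling and for the charts. -/
theorem isOpenQuotientMap_mk (d q : ℕ) :
    IsOpenQuotientMap (Quotient.mk (soSetoid d q)) := by
  refine ⟨Quotient.mk_surjective, continuous_quotient_mk', fun U hU => ?_⟩
  rw [← isQuotientMap_quotient_mk'.isOpen_preimage]
  have : Quotient.mk (soSetoid d q) ⁻¹' (Quotient.mk (soSetoid d q) '' U) =
      ⋃ A ∈ Matrix.specialOrthogonalGroup (Fin d) ℝ, (fun v i => act A (v i)) ⁻¹' U := by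
    ext v
    simp only [Set.mem_preimage, Set.mem_image, Set.mem_iUnion, exists_prop]
    constructor
    · rintro ⟨u, hu, h⟩
      obtain ⟨A, hA, h⟩ := (soSetoid d q).symm (Quotient.exact h)
      exact ⟨A, hA, by simpa [h] using hu⟩
    · rintro ⟨A, hA, h⟩
      exact ⟨_, h, Quotient.sound ((soSetoid d q).symm ⟨A, hA, fun _ => rfl⟩)⟩
  exact this ▸ isOpen_biUnion fun A _ => hU.preimage (continuous_act_tuple A)

/-- The graph of the action is closed, and projecting away the compact factor SO(d) is a closed map.
Closedness of the relation makes the quotient Hausdorff. -/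
theorem isClosed_soSetoid (d q : ℕ) :
    IsClosed {p : (Fin q → E d) × (Fin q → E d) | soSetoid d q p.1 p.2} := by
  have : CompactSpace (Matrix.specialOrthogonalGroup (Fin d) ℝ) :=
    isCompact_iff_compactSpace.1 (isCompact_specialOrthogonalGroup d)
  let K := Matrix.specialOrthogonalGroup (Fin d) ℝ
  let Z : Set (K × ((Fin q → E d) × (Fin q → E d))) := {x | ∀ i, act x.1.1 (x.2.1 i) = x.2.2 i}
  have hZ : IsClosed Z := by
    simp only [Z, Set.ofPred_forall]
    refine isClosed_iInter fun i => isClosed_eq ?_ (by fun_prop)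
    exact continuous_act.comp (by fun_prop :
      Continuous fun x : K × ((Fin q → E d) × (Fin q → E d)) =>
      (x.1.1, x.2.1 i))
  convert isClosedMap_snd_of_compactSpace _ hZ using 1
  ext p
  constructor
  · rintro ⟨A, hA, h⟩
    exact ⟨(⟨A, hA⟩, p), h, rfl⟩
  · rintro ⟨⟨A, p⟩, h, rfl⟩
    exact ⟨A.1, A.2, h⟩

/-- The same compactness argument. It makes `vecIncl` a closed map and, through complements, yields
the openness of the charts in `exists_chart_emb`. -/
theorem isClosed_saturation {d q : ℕ} {C : Set (Fin q → E d)} (hC : IsClosed C) :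
    IsClosed {w | ∃ v ∈ C, soSetoid d q v w} := by
  have : CompactSpace (Matrix.specialOrthogonalGroup (Fin d) ℝ) :=
    isCompact_iff_compactSpace.1 (isCompact_specialOrthogonalGroup d)
  let K := Matrix.specialOrthogonalGroup (Fin d) ℝ
  have hZ : IsClosed {x : K × (Fin q → E d) | (fun i => act x.1.1 (x.2 i)) ∈ C} := by
    refine hC.preimage (continuous_pi fun i => ?_)
    exact continuous_act.comp (by fun_prop : Continuous fun x : K × (Fin q → E d) =>
      (x.1.1, x.2 i))
  convert isClosedMap_snd_of_compactSpace _ hZ using 1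
  ext w
  constructor
  · rintro ⟨v, hv, h⟩
    obtain ⟨A, hA, h⟩ := (soSetoid d q).symm h
    exact ⟨(⟨A, hA⟩, w), by simpa [h] using hv, rfl⟩
  · rintro ⟨⟨A, w⟩, h, rfl⟩
    exact ⟨_, h, (soSetoid d q).symm ⟨A.1, A.2, fun _ => rfl⟩⟩

instance (d q : ℕ) : T2Space (VecModSO d q) := by
  rw [t2Space_iff_of_isOpenQuotientMap (isOpenQuotientMap_mk d q)]
  convert isClosed_soSetoid d q using 2
  ext p
  exact Quotient.eq

/-! ### Tuples with the same Gram matrix -/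

/-- Combinations of v and of w with equal coefficients have equal norms. So every linear relation
among the v_i holds among the w_i, and matching the combinations descends to an isometry on the
span. -/
theorem exists_linearMap_of_gram {F : Type*} [NormedAddCommGroup F] [InnerProductSpace ℝ F]
    {d q : ℕ} {v : Fin q → E d} {w : Fin q → F}
    (h : ∀ i j, inner ℝ (v i) (v j) = inner ℝ (w i) (w j)) :
    ∃ L : Submodule.span ℝ (Set.range v) →ₗᵢ[ℝ] F,
      ∀ i, L ⟨v i, Submodule.subset_span ⟨i, rfl⟩⟩ = w i := by
  let f := Fintype.linearCombination ℝ v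
  let g := Fintype.linearCombination ℝ w
  have hfg : ∀ c, ‖f c‖ = ‖g c‖ := fun c => by
    have : inner ℝ (f c) (f c) = inner ℝ (g c) (g c) := by
      simp only [f, g, Fintype.linearCombination_apply, sum_inner, inner_sum, inner_smul_left,
        inner_smul_right, h]
    rw [@norm_eq_sqrt_real_inner _ _ _ (f c), this, ← norm_eq_sqrt_real_inner]
  have hker : LinearMap.ker f ≤ LinearMap.ker g := fun c hc => by
    rw [LinearMap.mem_ker, ← norm_eq_zero, ← hfg, LinearMap.mem_ker.1 hc, norm_zero]
  have hr : LinearMap.range f = Submodule.span ℝ (Set.range v) :=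
    Fintype.range_linearCombination ℝ v
  let L₀ : LinearMap.range f →ₗ[ℝ] F :=
    ((LinearMap.ker f).liftQ g hker).comp (f.quotKerEquivRange.symm : _ →ₗ[ℝ] _)
  have hL₀ : ∀ c, L₀ ⟨f c, c, rfl⟩ = g c := fun c => by
    change (LinearMap.ker f).liftQ g hker (f.quotKerEquivRange.symm ⟨f c, _⟩) = _
    have : f.quotKerEquivRange.symm ⟨f c, c, rfl⟩ = (LinearMap.ker f).mkQ c := by
      rw [LinearEquiv.symm_apply_eq]
      rfl
    rw [this]
    rfl
  let L₁ : LinearMap.range f →ₗᵢ[ℝ] F := ⟨L₀, by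
    rintro ⟨_, c, rfl⟩
    rw [hL₀]
    exact (hfg c).symm⟩
  refine ⟨L₁.comp (LinearIsometryEquiv.ofEq _ _ hr.symm).toLinearIsometry, fun i => ?_⟩
  have e : f (Pi.single i 1) = v i := by simp [f]
  have e' : g (Pi.single i 1) = w i := by simp [g]
  rw [← e', ← hL₀]
  change L₀ _ = L₀ _
  congr 1
  exact Subtype.ext e.symm

theorem exists_matrix_of_linearIsometry {d : ℕ} (L : E d →ₗᵢ[ℝ] E d) :
    ∃ A ∈ Matrix.orthogonalGroup (Fin d) ℝ, ∀ v, act A v = L v := by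
  refine ⟨Matrix.toEuclideanLin.symm L.toLinearMap, ?_, fun v => ?_⟩
  · rw [Matrix.mem_orthogonalGroup_iff']
    ext i j
    have h := L.inner_map_map (EuclideanSpace.single j 1) (EuclideanSpace.single i 1)
    rw [inner_eq_sum, inner_eq_sum] at h
    simp only [Matrix.mul_apply, Matrix.transpose_apply]
    have key : ∀ a b, Matrix.toEuclideanLin.symm L.toLinearMap a b =
        L (EuclideanSpace.single b 1) a := fun a b => by
      have : L (EuclideanSpace.single b 1) =
          act (Matrix.toEuclideanLin.symm L.toLinearMap) (EuclideanSpace.single b 1) := by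
        simp [act_eq_toEuclideanLin]
      rw [this, act_apply]
      simp
    simp only [key]
    convert h using 1
    · exact Finset.sum_congr rfl fun _ _ => mul_comm _ _
    · simp [Matrix.one_apply]
  · simp [act_eq_toEuclideanLin]

/-- An isometry from a subspace of ℝ^d into ℝ^d extends to all of ℝ^d, so the Gram matrix is a
complete invariant of O(d)-orbits. -/
theorem oSetoid_of_gram {d q : ℕ} {v w : Fin q → E d}
    (h : ∀ i j, inner ℝ (v i) (v j) = inner ℝ (w i) (w j)) : oSetoid d q v w := by
  obtain ⟨L, hL⟩ := exists_linearMap_of_gram h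
  obtain ⟨A, hA, h'⟩ := exists_matrix_of_linearIsometry L.extend
  exact ⟨A, hA, fun i => by
    rw [h', ← hL i]
    exact L.extend_apply ⟨v i, Submodule.subset_span ⟨i, rfl⟩⟩⟩

theorem gram_eq_of_oSetoid {d q : ℕ} {v w : Fin q → E d} (h : oSetoid d q v w) (i j : Fin q) :
    inner ℝ (v i) (v j) = inner ℝ (w i) (w j) := by
  obtain ⟨A, hA, h⟩ := h
  rw [← h i, ← h j, inner_act hA]

theorem oSetoid_of_soSetoid {d q : ℕ} {v w : Fin q → E d} (h : soSetoid d q v w) :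
    oSetoid d q v w := by
  obtain ⟨A, hA, h⟩ := h
  exact ⟨A, (Matrix.mem_specialOrthogonalGroup_iff.1 hA).1, h⟩

/-- The reflection in a coordinate hyperplane. -/
def flip {d : ℕ} (a : Fin d) : Matrix (Fin d) (Fin d) ℝ :=
  Matrix.diagonal fun i => if i = a then -1 else 1

theorem flip_mem {d : ℕ} (a : Fin d) : flip a ∈ Matrix.orthogonalGroup (Fin d) ℝ := by
  rw [Matrix.mem_orthogonalGroup_iff, flip, Matrix.diagonal_transpose,
    Matrix.diagonal_mul_diagonal, ← Matrix.diagonal_one]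
  congr 1
  funext i
  by_cases hi : i = a <;> simp [hi]

theorem det_flip {d : ℕ} (a : Fin d) : (flip a).det = -1 := by
  rw [flip, Matrix.det_diagonal, Finset.prod_ite_eq' Finset.univ a]
  simp

theorem act_flip {d : ℕ} (a : Fin d) (v : E d) (i : Fin d) :
    act (flip a) v i = if i = a then -v i else v i := by
  simp only [act, flip, Matrix.mulVec_diagonal]
  split_ifs <;> simp

theorem det_eq_one_or_neg_one {d : ℕ} {A : Matrix (Fin d) (Fin d) ℝ}
    (hA : A ∈ Matrix.orthogonalGroup (Fin d) ℝ) : A.det = 1 ∨ A.det = -1 := by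
  have h : Aᵀ * A = 1 := (Matrix.mem_orthogonalGroup_iff' _ _).1 hA
  have := congrArg Matrix.det h
  rw [Matrix.det_mul, Matrix.det_transpose, Matrix.det_one] at this
  exact mul_self_eq_one_iff.1 this

/-- The reflection in the a-th coordinate hyperplane fixes w, so it can correct a determinant -1. -/
theorem soSetoid_of_oSetoid {d q : ℕ} {v w : Fin q → E d} (a : Fin d) (hw : ∀ i, w i a = 0)
    (h : oSetoid d q v w) : soSetoid d q v w := by
  obtain ⟨A, hA, h⟩ := h
  rcases det_eq_one_or_neg_one hA with hd | hd
  · exact ⟨A, Matrix.mem_specialOrthogonalGroup_iff.2 ⟨hA, hd⟩, h⟩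
  · refine ⟨flip a * A, Matrix.mem_specialOrthogonalGroup_iff.2 ⟨mul_mem (flip_mem a) hA, ?_⟩,
      fun i => ?_⟩
    · rw [Matrix.det_mul, det_flip, hd]
      norm_num
    · rw [act_mul, h]
      ext b
      rw [act_flip]
      split_ifs with hb
      · simp [hb, hw]
      · rfl

/-! ### The rank on `(ℝ^p)^q / SO(p)` -/

/-- The dimension of the span of a tuple. -/
def trank {p q : ℕ} (v : Fin q → E p) : ℕ := Module.finrank ℝ (Submodule.span ℝ (Set.range v))

theorem trank_eq_of_oSetoid {p q : ℕ} {v w : Fin q → E p} (h : oSetoid p q v w) :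
    trank v = trank w := by
  obtain ⟨A, _, h'⟩ := (oSetoid p q).symm h
  obtain ⟨B, _, h⟩ := h
  exact le_antisymm (finrank_span_le_of_act A h') (finrank_span_le_of_act B h)

/-- The rank of a point of `(ℝ^p)^q / SO(p)`. -/
def vrank {p q : ℕ} (z : VecModSO p q) : ℕ :=
  Quotient.lift trank (fun _ _ h => trank_eq_of_oSetoid (oSetoid_of_soSetoid h)) z

theorem vrank_mk {p q : ℕ} (v : Fin q → E p) : vrank (Quotient.mk (soSetoid p q) v) = trank v := rfl

theorem trank_le {p q : ℕ} (v : Fin q → E p) : trank v ≤ p := by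
  simpa [trank] using Submodule.finrank_le (Submodule.span ℝ (Set.range v))

theorem trank_eq_zero {p q : ℕ} {v : Fin q → E p} : trank v = 0 ↔ v = 0 := by
  rw [trank, Submodule.finrank_eq_zero, Submodule.span_eq_bot]
  simp [funext_iff]

/-- `pad` as a linear map. -/
def padL (m d : ℕ) : E m →ₗ[ℝ] E d where
  toFun := pad d
  map_add' := pad_add d
  map_smul' := pad_smul d

/-- `pad` as a linear isometry. -/
def padI {m d : ℕ} (h : m ≤ d) : E m →ₗᵢ[ℝ] E d where
  toLinearMap := padL m d
  norm_map' := norm_pad h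

theorem inner_pad {m d : ℕ} (h : m ≤ d) (v w : E m) :
    inner ℝ (pad d v) (pad d w) = inner ℝ v w := (padI h).inner_map_map v w

theorem trank_pad {m d q : ℕ} (h : m ≤ d) (v : Fin q → E m) :
    trank (fun i => pad d (v i)) = trank v := by
  have : (fun i => pad d (v i)) = padL m d ∘ v := rfl
  rw [trank, this, Set.range_comp, Submodule.span_image]
  exact LinearEquiv.finrank_eq (Submodule.equivMapOfInjective _ (padI h).injective _).symm

theorem pad_apply_of_le {m d : ℕ} (v : E m) (a : Fin d) (h : m ≤ a) : pad d v a = 0 := by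
  simp [pad, h]

/-- A tuple of rank at most `m < d` can be rotated into `ℝ^m`. -/
theorem exists_pad_of_trank_le {m d q : ℕ} (hmd : m < d) {v : Fin q → E d} (hv : trank v ≤ m) :
    ∃ u : Fin q → E m, soSetoid d q (fun i => pad d (u i)) v := by
  let W := Submodule.span ℝ (Set.range v)
  let b := stdOrthonormalBasis ℝ W
  let L : W →ₗᵢ[ℝ] E m :=
    (padI (m := Module.finrank ℝ W) (d := m) hv).comp b.repr.toLinearIsometry
  let u : Fin q → E m := fun i => L ⟨v i, Submodule.subset_span ⟨i, rfl⟩⟩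
  -- The padded tuple has the Gram matrix of v, and its coordinate number m vanishes, which upgrades
  -- O(d) to SO(d).
  refine ⟨u, (soSetoid d q).symm (soSetoid_of_oSetoid ⟨m, hmd⟩
    (fun i => pad_apply_of_le _ _ le_rfl) (oSetoid_of_gram fun i j => ?_))⟩
  rw [inner_pad hmd.le, L.inner_map_map]
  rfl

theorem oSetoid_of_pad {m d q : ℕ} (hmd : m < d) {v w : Fin q → E m}
    (h : soSetoid d q (fun i => pad d (v i)) (fun i => pad d (w i))) : oSetoid m q v w := by
  refine oSetoid_of_gram fun i j => ?_
  have := gram_eq_of_oSetoid (oSetoid_of_soSetoid h) i j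
  rwa [inner_pad hmd.le, inner_pad hmd.le] at this

theorem vecIncl_injective {r p q : ℕ} (hrp : r < p) : Function.Injective (vecIncl q hrp) := by
  intro x y
  induction x using Quotient.inductionOn
  induction y using Quotient.inductionOn
  intro h
  exact Quotient.sound (oSetoid_of_pad hrp (Quotient.exact h))

theorem range_vecIncl {r p q : ℕ} (hrp : r < p) :
    Set.range (vecIncl q hrp) = {z | vrank z ≤ r} := by
  ext z
  constructor
  · rintro ⟨y, rfl⟩
    induction y using Quotient.inductionOn with | _ v => ?_
    change trank (fun i => pad p (v i)) ≤ r
    rw [trank_pad hrp.le]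
    exact trank_le v
  · induction z using Quotient.inductionOn with | _ v => ?_
    intro hv
    obtain ⟨u, hu⟩ := exists_pad_of_trank_le hrp hv
    exact ⟨Quotient.mk _ u, Quotient.sound hu⟩

theorem continuous_pad {m d : ℕ} : Continuous (pad d : E m → E d) :=
  (padL m d).continuous_of_finiteDimensional

theorem isClosedEmbedding_vecIncl {r p : ℕ} (q : ℕ) (hrp : r < p) :
    IsClosedEmbedding (vecIncl q hrp) := by
  refine .of_continuous_injective_isClosedMap ?_ (vecIncl_injective hrp) fun C hC => ?_
  · exact Continuous.quotient_map' (continuous_pi fun i => continuous_pad.comp (continuous_apply i)) _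
  · rw [← (isOpenQuotientMap_mk p q).isQuotientMap.isClosed_preimage]
    have hp : IsClosedEmbedding (fun (v : Fin q → E r) i => pad p (v i)) :=
      .piMap fun _ => (padI hrp.le).isometry.isClosedEmbedding
    convert isClosed_saturation (hp.isClosedMap _ (hC.preimage continuous_quotient_mk')) using 1
    ext w
    constructor
    · rintro ⟨y, hy, h⟩
      induction y using Quotient.inductionOn with | _ v => ?_
      exact ⟨_, ⟨v, hy, rfl⟩, Quotient.exact h⟩
    · rintro ⟨_, ⟨v, hv, rfl⟩, h⟩
      exact ⟨_, hv, Quotient.sound h⟩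

/-! ### Block decomposition of `ℝ^(k+e)` -/

/-- The concatenation `ℝ^k × ℝ^e → ℝ^(k+e)`. -/
def cat {k e : ℕ} (u : E k) (w : E e) : E (k + e) := WithLp.toLp 2 (Fin.append u.ofLp w.ofLp)

@[simp]
theorem cat_castAdd {k e : ℕ} (u : E k) (w : E e) (a : Fin k) : cat u w (Fin.castAdd e a) = u a := by
  simp [cat]

@[simp]
theorem cat_natAdd {k e : ℕ} (u : E k) (w : E e) (b : Fin e) : cat u w (Fin.natAdd k b) = w b := by
  simp [cat]

theorem ext_cat {k e : ℕ} {v v' : E (k + e)}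
    (h : ∀ a, v (Fin.castAdd e a) = v' (Fin.castAdd e a))
    (h' : ∀ b, v (Fin.natAdd k b) = v' (Fin.natAdd k b)) : v = v' := by
  ext i
  exact Fin.addCases h h' i

theorem inner_cat {k e : ℕ} (u u' : E k) (w w' : E e) :
    inner ℝ (cat u w) (cat u' w') = inner ℝ u u' + inner ℝ w w' := by
  simp [inner_eq_sum, Fin.sum_univ_add]

theorem cat_inj {k e : ℕ} {u u' : E k} {w w' : E e} (h : cat u w = cat u' w') : u = u' ∧ w = w' := by
  constructor
  · ext a
    simpa using congrArg (fun v : E (k + e) => v (Fin.castAdd e a)) h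
  · ext a
    simpa using congrArg (fun v : E (k + e) => v (Fin.natAdd k a)) h

/-- Concatenation as a linear map. -/
def catL (k e : ℕ) : E k × E e →ₗ[ℝ] E (k + e) where
  toFun p := cat p.1 p.2
  map_add' p p' := ext_cat (by simp) (by simp)
  map_smul' c p := ext_cat (by simp) (by simp)

theorem catL_injective (k e : ℕ) : Function.Injective (catL k e) := fun _ _ h =>
  Prod.ext (cat_inj h).1 (cat_inj h).2

theorem continuous_cat {k e : ℕ} : Continuous fun p : E k × E e => cat p.1 p.2 :=
  (catL k e).continuous_of_finiteDimensional

/-- The block matrix with blocks `1` and `B`. -/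
def blk (k : ℕ) {e : ℕ} (B : Matrix (Fin e) (Fin e) ℝ) : Matrix (Fin (k + e)) (Fin (k + e)) ℝ :=
  (Matrix.fromBlocks 1 0 0 B).submatrix finSumFinEquiv.symm finSumFinEquiv.symm

theorem act_blk_cat {k e : ℕ} (B : Matrix (Fin e) (Fin e) ℝ) (u : E k) (w : E e) :
    act (blk k B) (cat u w) = cat u (act B w) := by
  refine ext_cat (fun a => ?_) (fun b => ?_) <;>
    simp [act_apply, Fin.sum_univ_add, blk, Matrix.one_apply]

theorem blk_mem {k e : ℕ} {B : Matrix (Fin e) (Fin e) ℝ}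
    (hB : B ∈ Matrix.specialOrthogonalGroup (Fin e) ℝ) :
    blk k B ∈ Matrix.specialOrthogonalGroup (Fin (k + e)) ℝ := by
  rw [Matrix.mem_specialOrthogonalGroup_iff, Matrix.mem_orthogonalGroup_iff] at hB ⊢
  refine ⟨?_, ?_⟩
  · rw [blk, Matrix.transpose_submatrix, Matrix.submatrix_mul_equiv, Matrix.fromBlocks_transpose,
      Matrix.fromBlocks_multiply, hB.1]
    simp
  · rw [blk, Matrix.det_submatrix_equiv_self, Matrix.det_fromBlocks_zero₁₂, hB.2]
    simp

/-! ### Orthogonal matrices relating triangular matrices -/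

/-- Uniqueness in the LQ decomposition: O = T⁻¹T' and Oᵀ = T'⁻¹T are both lower triangular, so O is
diagonal with entries ±1. -/
theorem orthogonal_of_triangular {k : ℕ} {T T' O : Matrix (Fin k) (Fin k) ℝ}
    (hT : T.IsLowerTriangular) (hT' : T'.IsLowerTriangular) (hu : IsUnit T) (hu' : IsUnit T')
    (hO : O * Oᵀ = 1) (h : T * O = T') :
    (∀ a b, a ≠ b → O a b = 0) ∧ ∀ a, O a a * O a a = 1 ∧ T a a * O a a = T' a a := by
  have : Invertible T := hu.invertible
  have : Invertible T' := hu'.invertible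
  have h1 : O = T⁻¹ * T' := by rw [← h, Matrix.inv_mul_cancel_left_of_invertible]
  have h2 : Oᵀ = T'⁻¹ * T := by
    have : T' * Oᵀ = T := by rw [← h, mul_assoc, hO, mul_one]
    rw [← this, Matrix.inv_mul_cancel_left_of_invertible]
  have l1 : O.IsLowerTriangular := h1 ▸
    BlockTriangular.mul (blockTriangular_inv_of_blockTriangular hT) hT'
  have l2 : Oᵀ.IsLowerTriangular := h2 ▸
    BlockTriangular.mul (blockTriangular_inv_of_blockTriangular hT') hT
  have hd : ∀ a b, a ≠ b → O a b = 0 := fun a b hab => by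
    rcases lt_or_gt_of_ne hab with h | h
    · exact l1 (OrderDual.toDual_lt_toDual.2 h)
    · exact l2 (OrderDual.toDual_lt_toDual.2 h)
  refine ⟨hd, fun a => ⟨?_, ?_⟩⟩
  · have := congrFun (congrFun hO a) a
    rw [Matrix.mul_apply, Finset.sum_eq_single a] at this
    · simpa using this
    · intro b _ hb
      simp [hd a b hb.symm]
    · simp
  · have := congrFun (congrFun h a) a
    rw [Matrix.mul_apply, Finset.sum_eq_single a] at this
    · exact this
    · intro b _ hb
      simp [hd b a hb]
    · simp

/-! ### The slice -/

/-- The index set of the matrices with `q` rows and `k` columns that vanish above the diagonal. -/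
abbrev Tri (q k : ℕ) : Type := {x : Fin q × Fin k // (x.2 : ℕ) ≤ x.1}

/-- The rows of the matrix with entries `p` on and below the diagonal. -/
def rows {q k : ℕ} (p : Tri q k → ℝ) (i : Fin q) : E k :=
  WithLp.toLp 2 fun a => if h : (a : ℕ) ≤ i then p ⟨(i, a), h⟩ else 0

/-- The diagonal entries. -/
def diag {k r : ℕ} (p : Tri (k + r) k → ℝ) (i : Fin k) : ℝ := p ⟨(Fin.castAdd r i, i), le_rfl⟩

/-- The tuple whose components in `ℝ^k` are the rows of `p`, and whose components in `ℝ^e` are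
`0` and then `w`. -/
def emb {k e r : ℕ} (p : Tri (k + r) k → ℝ) (w : Fin r → E e) : Fin (k + r) → E (k + e) :=
  fun i => cat (rows p i) (Fin.append (fun _ : Fin k => (0 : E e)) w i)

theorem emb_castAdd {k e r : ℕ} (p : Tri (k + r) k → ℝ) (w : Fin r → E e) (i : Fin k) :
    emb p w (Fin.castAdd r i) = cat (rows p (Fin.castAdd r i)) 0 := by
  simp [emb]

theorem emb_natAdd {k e r : ℕ} (p : Tri (k + r) k → ℝ) (w : Fin r → E e) (i : Fin r) :
    emb p w (Fin.natAdd k i) = cat (rows p (Fin.natAdd k i)) (w i) := by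
  simp [emb]

/-- `rows` as a linear map. -/
def rowsL (q k : ℕ) (i : Fin q) : (Tri q k → ℝ) →L[ℝ] E k :=
  LinearMap.toContinuousLinearMap
    { toFun := fun p => rows p i
      map_add' := fun p p' => by
        ext a
        by_cases h : (a : ℕ) ≤ i <;> simp [rows, h]
      map_smul' := fun c p => by
        ext a
        by_cases h : (a : ℕ) ≤ i <;> simp [rows, h] }

theorem rowsL_apply (q k : ℕ) (i : Fin q) (p : Tri q k → ℝ) : rowsL q k i p = rows p i := rfl

theorem continuous_emb {k e r : ℕ} :
    Continuous fun x : (Tri (k + r) k → ℝ) × (Fin r → E e) => emb x.1 x.2 := by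
  have h : ∀ i : Fin (k + r), Continuous fun x : (Tri (k + r) k → ℝ) × (Fin r → E e) =>
      Fin.append (fun _ : Fin k => (0 : E e)) x.2 i := fun i => by
    induction i using Fin.addCases with
    | left i =>
      simp only [Fin.append_left]
      exact continuous_const
    | right i =>
      simp only [Fin.append_right]
      exact (continuous_apply i).comp continuous_snd
  exact continuous_pi fun i =>
    continuous_cat.comp (((rowsL _ _ i).continuous.comp continuous_fst).prodMk (h i))

/-- The triangular coordinates of a tuple. -/
def projP {k e r : ℕ} (y : Fin (k + r) → E (k + e)) : Tri (k + r) k → ℝ :=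
  fun x => y x.1.1 (Fin.castAdd e x.1.2)

/-- The components of a tuple in `ℝ^e`, omitting the first `k` vectors. -/
def projW {k e r : ℕ} (y : Fin (k + r) → E (k + e)) : Fin r → E e :=
  fun j => WithLp.toLp 2 fun b => y (Fin.natAdd k j) (Fin.natAdd k b)

theorem continuous_projP {k e r : ℕ} :
    Continuous (projP : (Fin (k + r) → E (k + e)) → _) := by
  unfold projP
  fun_prop

theorem continuous_projW {k e r : ℕ} :
    Continuous (projW : (Fin (k + r) → E (k + e)) → _) := by
  unfold projW
  fun_prop

@[simp]
theorem projP_emb {k e r : ℕ} (p : Tri (k + r) k → ℝ) (w : Fin r → E e) : projP (emb p w) = p := by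
  funext ⟨⟨i, a⟩, h⟩
  simp only at h
  simp [projP, emb, rows, h]

@[simp]
theorem projW_emb {k e r : ℕ} (p : Tri (k + r) k → ℝ) (w : Fin r → E e) : projW (emb p w) = w := by
  funext j
  ext b
  simp [projW, emb]

theorem emb_proj {k e r : ℕ} {y : Fin (k + r) → E (k + e)}
    (h : ∀ (i : Fin k) (a : Fin (k + e)), (i : ℕ) < a → y (Fin.castAdd r i) a = 0) :
    emb (projP y) (projW y) = y := by
  funext i
  refine ext_cat (fun a => ?_) (fun b => ?_)
  · simp only [emb, cat_castAdd, rows, projP]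
    split_ifs with h'
    · rfl
    · push Not at h'
      have hi : (i : ℕ) < k := h'.trans a.2
      exact (h ⟨i, hi⟩ (Fin.castAdd e a) h').symm
  · refine Fin.addCases (fun i => ?_) (fun i => ?_) i
    · rw [emb_castAdd, cat_natAdd, h]
      · rfl
      · simp
        omega
    · rw [emb_natAdd, cat_natAdd]
      rfl

/-- The first `k` rows as a square matrix. -/
def sq {k r : ℕ} (p : Tri (k + r) k → ℝ) : Matrix (Fin k) (Fin k) ℝ :=
  fun i => (rows p (Fin.castAdd r i)).ofLp

theorem sq_lower {k r : ℕ} (p : Tri (k + r) k → ℝ) : (sq p).IsLowerTriangular := by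
  intro i a h
  have h : i < a := OrderDual.toDual_lt_toDual.1 h
  simp [sq, rows, h]

theorem sq_diag {k r : ℕ} (p : Tri (k + r) k → ℝ) (i : Fin k) : sq p i i = diag p i := by
  simp [sq, rows, diag]

theorem isUnit_sq {k r : ℕ} (p : Tri (k + r) k → ℝ) : IsUnit (sq p) ↔ ∀ i, diag p i ≠ 0 := by
  rw [Matrix.isUnit_iff_isUnit_det, det_of_isLowerTriangular _ (sq_lower p), isUnit_iff_ne_zero,
    Finset.prod_ne_zero_iff]
  simp [sq_diag]

theorem linearIndependent_rows {k r : ℕ} (p : Tri (k + r) k → ℝ) :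
    LinearIndependent ℝ (fun i : Fin k => rows p (Fin.castAdd r i)) ↔ ∀ i, diag p i ≠ 0 := by
  rw [← isUnit_sq, ← linearIndependent_rows_iff_isUnit,
    ← (WithLp.linearEquiv 2 ℝ (Fin k → ℝ)).toLinearMap.linearIndependent_iff
      (LinearEquiv.ker _)]
  rfl

theorem linearIndependent_emb {k e r : ℕ} (p : Tri (k + r) k → ℝ) (w : Fin r → E e) :
    LinearIndependent ℝ (fun i : Fin k => emb p w (Fin.castAdd r i)) ↔ ∀ i, diag p i ≠ 0 := by
  rw [← linearIndependent_rows,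
    ← ((catL k e).comp (LinearMap.inl ℝ _ _)).linearIndependent_iff
      (LinearMap.ker_eq_bot.2 ((catL_injective k e).comp (LinearMap.inl_injective)))]
  simp only [emb_castAdd]
  rfl

/-- The first k vectors already span ℝ^k × 0; modulo that subspace the remaining ones are 0 × w. -/
theorem trank_emb {k e r : ℕ} {p : Tri (k + r) k → ℝ} (hp : ∀ i, diag p i ≠ 0)
    (w : Fin r → E e) : trank (emb p w) = k + trank w := by
  let f := (catL k e).comp (LinearMap.inl ℝ _ _)
  let g := (catL k e).comp (LinearMap.inr ℝ (E k) (E e))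
  have hf : Function.Injective f := (catL_injective k e).comp LinearMap.inl_injective
  have hg : Function.Injective g := (catL_injective k e).comp LinearMap.inr_injective
  let W := Submodule.span ℝ (Set.range w)
  have hfS : ∀ u, f u ∈ Submodule.span ℝ (Set.range (emb p w)) := fun u => by
    have ht := ((linearIndependent_rows p).2 hp).span_eq_top_of_card_eq_finrank' (by simp)
    have hu : u ∈ Submodule.span ℝ (Set.range fun i : Fin k => rows p (Fin.castAdd r i)) :=
      ht ▸ Submodule.mem_top
    have := Submodule.mem_map_of_mem (f := f) hu
    rw [Submodule.map_span, ← Set.range_comp] at this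
    refine Submodule.span_mono ?_ this
    rintro _ ⟨i, rfl⟩
    exact ⟨Fin.castAdd r i, emb_castAdd p w i⟩
  have key : Submodule.span ℝ (Set.range (emb p w)) = LinearMap.range f ⊔ W.map g := by
    have hcat : ∀ u v, cat u v = f u + g v := fun u v => by
      refine ext_cat (fun a => ?_) (fun b => ?_) <;> simp [f, g, catL]
    apply le_antisymm
    · rw [Submodule.span_le]
      rintro _ ⟨i, rfl⟩
      refine Fin.addCases (fun i => ?_) (fun i => ?_) i
      · rw [emb_castAdd, hcat, map_zero, add_zero]
        exact Submodule.mem_sup_left ⟨_, rfl⟩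
      · rw [emb_natAdd, hcat]
        exact Submodule.add_mem_sup ⟨_, rfl⟩
          (Submodule.mem_map_of_mem (Submodule.subset_span ⟨i, rfl⟩))
    · refine sup_le ?_ ?_
      · rintro _ ⟨u, rfl⟩
        exact hfS u
      · rw [Submodule.map_span, Submodule.span_le]
        rintro _ ⟨_, ⟨i, rfl⟩, rfl⟩
        have : g (w i) = emb p w (Fin.natAdd k i) - f (rows p (Fin.natAdd k i)) := by
          rw [emb_natAdd, hcat, add_sub_cancel_left]
        rw [SetLike.mem_coe, this]
        exact Submodule.sub_mem _ (Submodule.subset_span ⟨_, rfl⟩) (hfS _)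
  have hinf : LinearMap.range f ⊓ W.map g = ⊥ := by
    rw [Submodule.eq_bot_iff]
    rintro _ ⟨⟨u, rfl⟩, v, -, hv⟩
    have : (u, (0 : E e)) = (0, v) := (catL_injective k e hv).symm
    have h0 : u = 0 := (Prod.ext_iff.1 this).1
    rw [h0, map_zero]
  have := Submodule.finrank_sup_add_finrank_inf_eq (LinearMap.range f) (W.map g)
  rw [hinf, ← key, finrank_bot, add_zero, LinearMap.finrank_range_of_inj hf,
    ← (Submodule.equivMapOfInjective g hg W).finrank_eq] at this
  simpa [trank] using this

/-! ### Orbits and the slice -/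

/-- The sign condition that makes the slice unique. -/
def Pos {k r : ℕ} (e : ℕ) (p : Tri (k + r) k → ℝ) : Prop :=
  (∀ i, diag p i ≠ 0) ∧ ∀ i : Fin k, (i : ℕ) + 1 < k + e → 0 < diag p i

theorem isOpen_pos {k r : ℕ} (e : ℕ) : IsOpen {p : Tri (k + r) k → ℝ | Pos e p} := by
  simp only [Pos, Set.ofPred_and, Set.ofPred_forall]
  unfold diag
  refine (isOpen_iInter_of_finite fun i => isOpen_ne_fun (by fun_prop) (by fun_prop)).inter
    (isOpen_iInter_of_finite fun i => isOpen_iInter_of_finite fun _ =>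
      isOpen_lt (by fun_prop) (by fun_prop))

theorem soSetoid_emb {k e r : ℕ} (p : Tri (k + r) k → ℝ) {w w' : Fin r → E e}
    (h : soSetoid e r w w') : soSetoid (k + e) (k + r) (emb p w) (emb p w') := by
  obtain ⟨B, hB, h⟩ := h
  refine ⟨blk k B, blk_mem hB, fun i => Fin.addCases (fun i => ?_) (fun i => ?_) i⟩
  · rw [emb_castAdd, emb_castAdd, act_blk_cat, act_zero]
  · rw [emb_natAdd, emb_natAdd, act_blk_cat, h]

/-- Write the rotation in blocks. It maps the first k vectors, which span ℝ^k × 0, into ℝ^k × 0, so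
A₃ = 0, and orthogonality then gives A₂ = 0. The block A₁ relates two triangular matrices, hence is
diagonal with entries ±1, and the sign condition makes it the identity. The block A₄ is the
remaining element of SO(e). -/
theorem eq_of_soSetoid_emb {k e r : ℕ} {p p' : Tri (k + r) k → ℝ} (hp : Pos e p) (hp' : Pos e p')
    {w w' : Fin r → E e} (h : soSetoid (k + e) (k + r) (emb p w) (emb p' w')) :
    p = p' ∧ soSetoid e r w w' := by
  obtain ⟨A, hA, h⟩ := h
  rw [Matrix.mem_specialOrthogonalGroup_iff] at hA
  have hA1 := (Matrix.mem_orthogonalGroup_iff _ _).1 hA.1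
  have hA2 := (Matrix.mem_orthogonalGroup_iff' _ _).1 hA.1
  obtain ⟨M, rfl⟩ : ∃ M : Matrix (Fin k ⊕ Fin e) (Fin k ⊕ Fin e) ℝ,
      A = M.submatrix finSumFinEquiv.symm finSumFinEquiv.symm :=
    ⟨A.submatrix finSumFinEquiv finSumFinEquiv, by simp⟩
  obtain ⟨A₁, A₂, A₃, A₄, rfl⟩ : ∃ A₁ A₂ A₃ A₄, M = Matrix.fromBlocks A₁ A₂ A₃ A₄ :=
    ⟨_, _, _, _, (Matrix.fromBlocks_toBlocks M).symm⟩
  have hdet := hA.2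
  rw [Matrix.det_submatrix_equiv_self] at hdet
  have hone : (1 : Matrix (Fin (k + e)) (Fin (k + e)) ℝ) =
      (Matrix.fromBlocks 1 0 0 1).submatrix finSumFinEquiv.symm finSumFinEquiv.symm := by simp
  have hinj : Function.Injective fun M : Matrix (Fin k ⊕ Fin e) (Fin k ⊕ Fin e) ℝ =>
      M.submatrix finSumFinEquiv.symm finSumFinEquiv.symm :=
    (Matrix.reindex finSumFinEquiv finSumFinEquiv).injective
  rw [Matrix.transpose_submatrix, Matrix.submatrix_mul_equiv, Matrix.fromBlocks_transpose,
    Matrix.fromBlocks_multiply, hone] at hA1 hA2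
  obtain ⟨h11, -⟩ := Matrix.fromBlocks_inj.1 (hinj hA1)
  obtain ⟨h11', -⟩ := Matrix.fromBlocks_inj.1 (hinj hA2)
  have hu := (isUnit_sq p).2 hp.1
  have hu' := (isUnit_sq p').2 hp'.1
  have hcol : ∀ (i : Fin k) (a : Fin (k + e)), cat (rows p' (Fin.castAdd r i)) (0 : E e) a =
      ∑ b, (Matrix.fromBlocks A₁ A₂ A₃ A₄).submatrix finSumFinEquiv.symm finSumFinEquiv.symm a b *
        cat (rows p (Fin.castAdd r i)) (0 : E e) b := fun i a => by
    rw [← act_apply, ← emb_castAdd p' w', ← h, emb_castAdd]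
  have hT : sq p * A₁ᵀ = sq p' := by
    ext i a
    have := hcol i (Fin.castAdd e a)
    simp only [Fin.sum_univ_add, cat_castAdd, cat_natAdd] at this
    simpa [Matrix.mul_apply, sq, mul_comm] using this.symm
  have hT3 : sq p * A₃ᵀ = 0 := by
    ext i a
    have := hcol i (Fin.natAdd k a)
    simp only [Fin.sum_univ_add, cat_castAdd, cat_natAdd] at this
    simpa [Matrix.mul_apply, sq, mul_comm] using this.symm
  have h3 : A₃ = 0 := by
    have := hu.invertible
    rw [← Matrix.transpose_eq_zero, ← Matrix.inv_mul_cancel_left_of_invertible (sq p) A₃ᵀ, hT3,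
      Matrix.mul_zero]
  subst h3
  rw [Matrix.transpose_zero, Matrix.zero_mul, add_zero] at h11'
  have h11'' : A₁ * A₁ᵀ = 1 := mul_eq_one_comm.1 h11'
  have h2 : A₂ = 0 := by
    rw [h11'', add_eq_left] at h11
    rw [← Matrix.self_mul_conjTranspose_eq_zero,
      Matrix.conjTranspose_eq_transpose_of_trivial, h11]
  subst h2
  rw [Matrix.det_fromBlocks_zero₁₂] at hdet
  obtain ⟨hd, hs⟩ := orthogonal_of_triangular (sq_lower p) (sq_lower p') hu hu'
    (by rw [Matrix.transpose_transpose]; exact h11') hT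
  simp only [Matrix.transpose_apply, sq_diag] at hd hs
  have hone' : ∀ a : Fin k, (a : ℕ) + 1 < k + e → A₁ a a = 1 := fun a ha => by
    have h0 : 0 < A₁ a a := by
      have := hp'.2 a ha
      rw [← (hs a).2] at this
      exact (pos_iff_pos_of_mul_pos this).1 (hp.2 a ha)
    rcases mul_self_eq_one_iff.1 (hs a).1 with h | h <;> linarith
  have h1 : A₁ = 1 := by
    ext a b
    by_cases hab : a = b
    swap
    · rw [hd b a (Ne.symm hab), Matrix.one_apply_ne hab]
    subst hab
    rw [Matrix.one_apply_eq]
    by_cases ha : (a : ℕ) + 1 < k + e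
    · exact hone' a ha
    -- Only when e = 0 is one diagonal entry, the last, exempt from the sign condition. There det A₁
    -- = 1, and all other entries are 1, so it is 1 as well.
    have he : e = 0 := by omega
    subst he
    have hdiag : A₁.IsLowerTriangular := fun i j h =>
      hd j i (ne_of_gt (OrderDual.toDual_lt_toDual.1 h))
    rw [Matrix.det_isEmpty (A := A₄), mul_one, det_of_isLowerTriangular _ hdiag,
      Finset.prod_eq_single a] at hdet
    · exact hdet
    · intro b _ hb
      refine hone' b ?_
      have : (b : ℕ) ≠ a := fun h => hb (Fin.ext h)
      omega
    · simp
  subst h1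
  rw [Matrix.det_one, one_mul] at hdet
  have hblk : (Matrix.fromBlocks 1 0 0 A₄).submatrix finSumFinEquiv.symm finSumFinEquiv.symm =
    blk k A₄ := rfl
  rw [hblk] at h
  have hh : ∀ i, rows p i = rows p' i := fun i => by
    have := h i
    rw [emb, act_blk_cat] at this
    exact (cat_inj this).1
  refine ⟨?_, A₄, ?_, fun i => ?_⟩
  · funext ⟨⟨i, a⟩, hx⟩
    have := congrArg (fun v : E k => v a) (hh i)
    simp only at hx
    simpa [rows, hx] using this
  · obtain ⟨-, -, -, h44⟩ := Matrix.fromBlocks_inj.1 (hinj hA1)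
    rw [Matrix.mem_specialOrthogonalGroup_iff, Matrix.mem_orthogonalGroup_iff]
    exact ⟨by simpa using h44, hdet⟩
  · have := h (Fin.natAdd k i)
    rw [emb_natAdd, emb_natAdd, act_blk_cat] at this
    exact (cat_inj this).2

theorem linearIndependent_of_soSetoid {d q k : ℕ} {v w : Fin q → E d} (h : soSetoid d q v w)
    {f : Fin k → Fin q} (hv : LinearIndependent ℝ (v ∘ f)) : LinearIndependent ℝ (w ∘ f) := by
  obtain ⟨A, hA, h⟩ := h
  have : w ∘ f = Matrix.toEuclideanLin A ∘ (v ∘ f) := funext fun i => (h (f i)).symm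
  rw [this]
  refine hv.map' _ (LinearMap.ker_eq_bot'.2 fun x hx => ?_)
  have := norm_act (Matrix.mem_specialOrthogonalGroup_iff.1 hA).1 x
  rw [act_eq_toEuclideanLin, hx, norm_zero] at this
  exact norm_eq_zero.1 this.symm

/-- Every orbit of tuples whose first `k` vectors are linearly independent meets the slice. -/
theorem exists_emb {k e r : ℕ} {y : Fin (k + r) → E (k + e)}
    (hy : LinearIndependent ℝ (y ∘ Fin.castAdd r)) :
    ∃ (p : Tri (k + r) k → ℝ) (w : Fin r → E e), Pos e p ∧
      soSetoid (k + e) (k + r) y (emb p w) := by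
  -- The zero vectors only fill up the family: Gram–Schmidt still returns an orthonormal basis of
  -- the whole space, triangular with respect to the first k vectors.
  let f : Fin (k + e) → E (k + e) := Fin.append (y ∘ Fin.castAdd r) 0
  have hcard : Module.finrank ℝ (E (k + e)) = Fintype.card (Fin (k + e)) := by simp
  let b := InnerProductSpace.gramSchmidtOrthonormalBasis hcard f
  have hb : ∀ i j, i < j → inner ℝ (b j) (f i) = 0 := fun i j hij =>
    InnerProductSpace.gramSchmidtOrthonormalBasis_inv_triangular hcard f hij
  -- The signs turn the diagonal entries nonnegative. The rows of A below are the signed basis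
  -- vectors.
  let s : Fin (k + e) → ℝ := fun a => if inner ℝ (b a) (f a) < 0 then -1 else 1
  have hs : ∀ a, s a * s a = 1 := fun a => by
    simp only [s]
    split_ifs <;> norm_num
  have hs' : ∀ a, 0 ≤ s a * inner ℝ (b a) (f a) := fun a => by
    simp only [s]
    split_ifs with h <;> linarith
  obtain ⟨A, hAac⟩ : ∃ A : Matrix (Fin (k + e)) (Fin (k + e)) ℝ, ∀ a c, A a c = s a * b a c :=
    ⟨fun a c => s a * b a c, fun _ _ => rfl⟩
  have hAv : ∀ v a, act A v a = s a * inner ℝ (b a) v := fun v a => by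
    simp only [act_apply, hAac, inner_eq_sum, Finset.mul_sum, mul_assoc]
  have hA : A ∈ Matrix.orthogonalGroup (Fin (k + e)) ℝ := by
    rw [Matrix.mem_orthogonalGroup_iff]
    ext a c
    have h := orthonormal_iff_ite.1 b.orthonormal a c
    rw [inner_eq_sum] at h
    have : (A * Aᵀ) a c = s a * s c * ∑ i, b a i * b c i := by
      simp only [Matrix.mul_apply, Matrix.transpose_apply, hAac, Finset.mul_sum]
      exact Finset.sum_congr rfl fun _ _ => by ring
    rw [this, h, Matrix.one_apply]
    split_ifs with hac
    · rw [hac, hs, mul_one]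
    · rw [mul_zero]
  -- If det A = -1, the last coordinate is reflected. This spoils at most the one sign that `Pos`
  -- leaves free.
  obtain ⟨A', hA', t, ht, ht', hAA'⟩ : ∃ A' ∈ Matrix.specialOrthogonalGroup (Fin (k + e)) ℝ,
      ∃ t : Fin (k + e) → ℝ, (∀ a, t a ≠ 0) ∧ (∀ a : Fin (k + e), (a : ℕ) + 1 < k + e → t a = 1) ∧
        ∀ v a, act A' v a = t a * act A v a := by
    rcases det_eq_one_or_neg_one hA with hd | hd
    · exact ⟨A, Matrix.mem_specialOrthogonalGroup_iff.2 ⟨hA, hd⟩, fun _ => 1, by simp, by simp,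
        by simp⟩
    · have hpos : 0 < k + e := by
        rcases Nat.eq_zero_or_pos (k + e) with h0 | h0
        · have : IsEmpty (Fin (k + e)) := by rw [h0]; infer_instance
          rw [Matrix.det_isEmpty] at hd
          norm_num at hd
        · exact h0
      let l : Fin (k + e) := ⟨k + e - 1, by omega⟩
      refine ⟨flip l * A, Matrix.mem_specialOrthogonalGroup_iff.2
        ⟨mul_mem (flip_mem l) hA, by rw [Matrix.det_mul, det_flip, hd]; norm_num⟩,
        fun a => if a = l then -1 else 1, fun a => ?_, fun a ha => ?_, fun v a => ?_⟩
      · dsimp only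
        split_ifs <;> norm_num
      · have : a ≠ l := fun h => by
          rw [h] at ha
          simp only [l] at ha
          omega
        simp [this]
      · rw [act_mul, act_flip]
        by_cases h : a = l <;> simp [h]
  let z : Fin (k + r) → E (k + e) := fun i => act A' (y i)
  have hyz : soSetoid (k + e) (k + r) y z := ⟨A', hA', fun _ => rfl⟩
  have hz : emb (projP z) (projW z) = z := emb_proj fun i a hia => by
    have : y (Fin.castAdd r i) = f (Fin.castAdd e i) := by simp [f]
    simp only [z]
    rw [hAA', hAv, this, hb (Fin.castAdd e i) a hia, mul_zero, mul_zero]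
  refine ⟨projP z, projW z, ⟨?_, fun i hi => ?_⟩, hz.symm ▸ hyz⟩
  · rw [← linearIndependent_emb _ (projW z), hz]
    exact linearIndependent_of_soSetoid hyz hy
  · refine lt_of_le_of_ne ?_ (Ne.symm ?_)
    · change 0 ≤ act A' (y (Fin.castAdd r i)) (Fin.castAdd e i)
      have : y (Fin.castAdd r i) = f (Fin.castAdd e i) := by simp [f]
      rw [hAA', ht' _ hi, one_mul, hAv, this]
      exact hs' _
    · revert i
      suffices ∀ i, diag (projP z) i ≠ 0 from fun i _ => this i
      rw [← linearIndependent_emb _ (projW z), hz]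
      exact linearIndependent_of_soSetoid hyz hy

/-! ### A chart for a level set depending on parameters -/

theorem univBall_zero_apply {V : Type*} [NormedAddCommGroup V] [NormedSpace ℝ V] {δ : ℝ}
    (hδ : 0 < δ) (v : V) :
    OpenPartialHomeomorph.univBall (0 : V) δ v = (δ * (√(1 + ‖v‖ ^ 2))⁻¹) • v := by
  rw [OpenPartialHomeomorph.univBall, dif_pos hδ]
  change δ • OpenPartialHomeomorph.univUnitBall v +ᵥ (0 : V) = _
  rw [OpenPartialHomeomorph.univUnitBall_apply, smul_smul, vadd_eq_add, add_zero]

/-- The implicit function theorem straightens p to (G p, component in the kernel of G'), so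
solutions of G p + H v = G p₀ are parametrised by v and a kernel vector. `univBall` squeezes the
full parameter spaces into small balls, which makes f global. For a fixed Euclidean parameter f
depends on w only through H, so it will inherit the invariance of H. The last clause is openness of
the parametrisation, phrased as the trace of an open N on the solution set. -/
theorem exists_implicit_chart {P F V : Type*} [NormedAddCommGroup P] [NormedSpace ℝ P]
    [FiniteDimensional ℝ P] [NormedAddCommGroup F] [NormedSpace ℝ F] [FiniteDimensional ℝ F]
    [NormedAddCommGroup V] [NormedSpace ℝ V] {G : P → F} {G' : P →L[ℝ] F} {p₀ : P}
    (hG : HasStrictFDerivAt G G' p₀) (hG' : G'.range = ⊤) {H : V → F} (hH : Continuous H)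
    (hH0 : H 0 = 0) {O : Set P} (hO : IsOpen O) (hp : p₀ ∈ O) {a : ℕ}
    (ha : Module.finrank ℝ P = a + Module.finrank ℝ F) :
    ∃ (δ : ℝ) (f : E a × V → P), 0 < δ ∧ Continuous f ∧ f (0, 0) = p₀ ∧
      (∀ x, f x ∈ O ∧ G (f x) + H (univBall 0 δ x.2) = G p₀) ∧
      (∀ κ κ' w w', H (univBall 0 δ w) = H (univBall 0 δ w') →
        (f (κ, w) = f (κ', w') ↔ κ = κ')) ∧
      ∀ U : Set (E a × V), IsOpen U → ∃ N : Set (P × V), IsOpen N ∧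
        ∀ p v, G p + H v = G p₀ → ((p, v) ∈ N ↔ ∃ x ∈ U, f x = p ∧ univBall 0 δ x.2 = v) := by
  have := FiniteDimensional.complete ℝ P
  have := FiniteDimensional.complete ℝ F
  let h := (hG.implicitToOpenPartialHomeomorph G G' hG').restrOpen O hO
  have hfst : ∀ p, (h p).1 = G p := hG.implicitToOpenPartialHomeomorph_fst hG'
  have hself : h p₀ = (G p₀, 0) := hG.implicitToOpenPartialHomeomorph_self hG'
  have hsrc : p₀ ∈ h.source := ⟨hG.mem_implicitToOpenPartialHomeomorph_source hG', hp⟩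
  have hsrcO : ∀ p ∈ h.source, p ∈ O := fun p hp => hp.2
  clear_value h
  have htgt : (G p₀, (0 : G'.ker)) ∈ h.target := hself ▸ h.map_source hsrc
  have hfr : Module.finrank ℝ G'.ker = a := by
    have := LinearMap.finrank_range_add_finrank_ker (G' : P →ₗ[ℝ] F)
    have h' : Module.finrank ℝ (LinearMap.range (G' : P →ₗ[ℝ] F)) = Module.finrank ℝ F := by
      rw [show LinearMap.range (G' : P →ₗ[ℝ] F) = ⊤ from hG', finrank_top]
    change _ + Module.finrank ℝ (LinearMap.ker (G' : P →ₗ[ℝ] F)) = _ at this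
    change Module.finrank ℝ (LinearMap.ker (G' : P →ₗ[ℝ] F)) = _
    omega
  let L : G'.ker ≃L[ℝ] E a := ContinuousLinearEquiv.ofFinrankEq (by rw [hfr]; simp)
  obtain ⟨ε, hε, hball⟩ := Metric.isOpen_iff.1 h.open_target _ htgt
  -- On the δ-ball H has norm below ε, so t takes values in the ε-ball around h p₀, inside the
  -- target of h.
  obtain ⟨δ, hδ, hHδ⟩ := Metric.continuousAt_iff.1 (hH.continuousAt (x := 0)) ε hε
  let b : OpenPartialHomeomorph G'.ker G'.ker := univBall 0 ε
  let ρ : OpenPartialHomeomorph V V := univBall 0 δ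
  have hb : ∀ x, b x ∈ Metric.ball 0 ε := fun x => by
    rw [← univBall_target (0 : G'.ker) hε]
    exact b.map_source (by simp [b])
  have hρ : ∀ x, ρ x ∈ Metric.ball 0 δ := fun x => by
    rw [← univBall_target (0 : V) hδ]
    exact ρ.map_source (by simp [ρ])
  have hbl : ∀ x, b.symm (b x) = x := fun x => b.left_inv (by simp [b])
  have hρl : ∀ x, ρ.symm (ρ x) = x := fun x => ρ.left_inv (by simp [ρ])
  have hbr : ∀ x ∈ Metric.ball 0 ε, b (b.symm x) = x := fun x hx =>
    b.right_inv (by rwa [univBall_target _ hε])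
  have hρr : ∀ x ∈ Metric.ball 0 δ, ρ (ρ.symm x) = x := fun x hx =>
    ρ.right_inv (by rwa [univBall_target _ hδ])
  let t : E a × V → F × G'.ker := fun x => (G p₀ - H (ρ x.2), b (L.symm x.1))
  have ht : ∀ x, t x ∈ h.target := fun x => by
    apply hball
    have h1 := hHδ (hρ x.2)
    rw [hH0, dist_zero_right] at h1
    have h2 := hb (L.symm x.1)
    rw [← ball_prod_same]
    exact ⟨by simpa [t, dist_eq_norm] using h1, h2⟩
  have htc : Continuous t := by
    refine Continuous.prodMk (continuous_const.sub (hH.comp ((continuous_univBall 0 δ).comp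
      continuous_snd))) ((continuous_univBall 0 ε).comp (L.symm.continuous.comp continuous_fst))
  refine ⟨δ, fun x => h.symm (t x), hδ, ?_, ?_, fun x => ⟨?_, ?_⟩, fun κ κ' w w' hw => ?_,
    fun U hU => ?_⟩
  · exact h.continuousOn_symm.comp_continuous htc ht
  · have : t (0, 0) = h p₀ := by
      rw [hself]
      simp [t, b, ρ, hH0]
    dsimp only
    rw [this, h.left_inv hsrc]
  · exact hsrcO _ (h.map_target (ht x))
  · rw [← hfst, h.right_inv (ht x)]
    exact sub_add_cancel _ _
  · constructor
    · intro hf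
      have := h.symm.injOn (ht (κ, w)) (ht (κ', w')) hf
      have := congrArg (fun y => L (b.symm y.2)) this
      simpa [t, hbl] using this
    · rintro rfl
      simp only [t]
      rw [show H (ρ w) = H (ρ w') from hw]
  · let D : Set (P × V) := (h.source ∩ h ⁻¹' (Set.univ ×ˢ Metric.ball 0 ε)) ×ˢ Metric.ball 0 δ
    have hD : IsOpen D := (h.continuousOn.isOpen_inter_preimage h.open_source
      (isOpen_univ.prod Metric.isOpen_ball)).prod Metric.isOpen_ball
    let g : P × V → E a × V := fun x => (L (b.symm (h x.1).2), ρ.symm x.2)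
    have hg : ContinuousOn g D := by
      refine ContinuousOn.prodMk (L.continuous.comp_continuousOn ?_) ?_
      · refine (continuousOn_univBall_symm (0 : G'.ker) ε).comp (t := Metric.ball 0 ε)
          (continuous_snd.comp_continuousOn (h.continuousOn.comp continuousOn_fst fun x hx => hx.1.1))
          fun x hx => hx.1.2.2
      · exact (continuousOn_univBall_symm (0 : V) δ).comp continuousOn_snd fun x hx => hx.2
    refine ⟨D ∩ g ⁻¹' U, hg.isOpen_inter_preimage hD hU, fun p v hpv => ⟨?_, ?_⟩⟩
    · rintro ⟨⟨⟨hp, -, hp2⟩, hv⟩, hx⟩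
      refine ⟨_, hx, ?_, hρr v hv⟩
      have : t (g (p, v)) = h p := by
        refine Prod.ext ?_ ?_
        · simp only [t, g]
          rw [hρr v hv, hfst, ← hpv, add_sub_cancel_right]
        · simp only [t, g, ContinuousLinearEquiv.symm_apply_apply]
          exact hbr _ hp2
      dsimp only
      rw [this, h.left_inv hp]
    · rintro ⟨x, hx, rfl, rfl⟩
      refine ⟨⟨⟨h.map_target (ht x), trivial, ?_⟩, hρ _⟩, ?_⟩
      · rw [h.right_inv (ht x)]
        exact hb _
      · have : g (h.symm (t x), ρ x.2) = x := by
          refine Prod.ext ?_ (hρl _)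
          simp only [g]
          rw [h.right_inv (ht x)]
          simp [t, hbl]
        change g (h.symm (t x), ρ x.2) ∈ U
        rwa [this]

/-! ### Quadratic constraints -/

/-- The quadratic form `∑ M_ij ⟨y_i, y_j⟩` on tuples. -/
def qform {d q : ℕ} (M : Matrix (Fin q) (Fin q) ℝ) (y : Fin q → E d) : ℝ :=
  ∑ i, ∑ j, M i j * inner ℝ (y i) (y j)

theorem continuous_qform {d q : ℕ} (M : Matrix (Fin q) (Fin q) ℝ) :
    Continuous (qform M : (Fin q → E d) → ℝ) := by
  unfold qform
  fun_prop

theorem qform_eq_of_oSetoid {d q : ℕ} (M : Matrix (Fin q) (Fin q) ℝ) {v w : Fin q → E d}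
    (h : oSetoid d q v w) : qform M v = qform M w := by
  simp only [qform, gram_eq_of_oSetoid h]

/-- The quadratic form on the quotient. -/
def qf {d q : ℕ} (M : Matrix (Fin q) (Fin q) ℝ) (z : VecModSO d q) : ℝ :=
  Quotient.lift (qform M) (fun _ _ h => qform_eq_of_oSetoid M (oSetoid_of_soSetoid h)) z

theorem continuous_qf {d q : ℕ} (M : Matrix (Fin q) (Fin q) ℝ) :
    Continuous (qf M : VecModSO d q → ℝ) :=
  (continuous_qform M).quotient_lift _

theorem qform_emb {k e r : ℕ} (M : Matrix (Fin (k + r)) (Fin (k + r)) ℝ)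
    (p : Tri (k + r) k → ℝ) (w : Fin r → E e) :
    qform M (emb p w) = qform M (rows p) + qform M (Fin.append (fun _ : Fin k => (0 : E e)) w) := by
  simp only [qform, emb, inner_cat, mul_add, Finset.sum_add_distrib]

/-- Let z = Mp. Criticality along triangular directions kills the entries of z on and below the
diagonal, so the (b, a) entry of pᵀz vanishes for a ≤ b. As pᵀz = pᵀMp is symmetric, it is zero. The
lower r rows of z vanish already, and the invertible top block of p then kills the rest. In effect
the slice is transverse to the orbits, along which the form is constant anyway. -/
theorem sum_smul_rows_eq_zero {k r : ℕ} {M : Matrix (Fin (k + r)) (Fin (k + r)) ℝ}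
    (hM : M.IsSymm) {p : Tri (k + r) k → ℝ} (hp : ∀ i, diag p i ≠ 0)
    (h : ∀ η : Tri (k + r) k → ℝ, ∑ i, ∑ j, M i j *
      (inner ℝ (rows p i) (rows η j) + inner ℝ (rows η i) (rows p j)) = 0) (i : Fin (k + r)) :
    ∑ j, M i j • rows p j = 0 := by
  let z : Fin (k + r) → E k := fun i => ∑ j, M i j • rows p j
  have hza : ∀ i a, z i a = ∑ j, M i j * rows p j a := fun i a => by
    simp [z, WithLp.ofLp_sum, Finset.sum_apply]
  have h1 : ∀ η : Tri (k + r) k → ℝ, ∑ i, inner ℝ (z i) (rows η i) = 0 := fun η => by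
    have e1 : ∑ i, ∑ j, M i j * inner ℝ (rows η i) (rows p j) = ∑ i, inner ℝ (z i) (rows η i) := by
      refine Finset.sum_congr rfl fun i _ => ?_
      rw [real_inner_comm, inner_sum]
      simp only [inner_smul_right]
    have e2 : ∑ i, ∑ j, M i j * inner ℝ (rows p i) (rows η j) = ∑ i, inner ℝ (z i) (rows η i) := by
      rw [Finset.sum_comm, ← e1]
      refine Finset.sum_congr rfl fun i _ => Finset.sum_congr rfl fun j _ => ?_
      rw [hM.apply, real_inner_comm]
    have := h η
    simp only [mul_add, Finset.sum_add_distrib, e1, e2] at this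
    linarith
  have h2 : ∀ (i : Fin (k + r)) (a : Fin k), (a : ℕ) ≤ i → z i a = 0 := fun i a hia => by
    have := h1 (Pi.single ⟨(i, a), hia⟩ 1)
    rw [Finset.sum_eq_single i, inner_eq_sum, Finset.sum_eq_single a] at this
    · simpa [rows, hia] using this
    · intro c _ hc
      have : rows (Pi.single (⟨(i, a), hia⟩ : Tri (k + r) k) (1 : ℝ)) i c = 0 := by
        simp only [rows]
        split_ifs with h'
        · rw [Pi.single_eq_of_ne]
          simpa using hc
        · rfl
      rw [this, mul_zero]
    · simp
    · intro j _ hj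
      have : rows (Pi.single (⟨(i, a), hia⟩ : Tri (k + r) k) (1 : ℝ)) j = 0 := by
        ext c
        simp only [rows]
        split_ifs with h'
        · rw [Pi.single_eq_of_ne]
          · rfl
          · simp [hj]
        · rfl
      rw [this, inner_zero_right]
    · simp
  have h3 : ∀ a b : Fin k, ∑ i, rows p i b * z i a = ∑ i, rows p i a * z i b := fun a b => by
    simp only [hza, Finset.mul_sum]
    rw [Finset.sum_comm]
    refine Finset.sum_congr rfl fun i _ => Finset.sum_congr rfl fun j _ => ?_
    rw [hM.apply]
    ring
  have h4 : ∀ a b : Fin k, a ≤ b → ∑ i, rows p i b * z i a = 0 := fun a b hab => by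
    refine Finset.sum_eq_zero fun i _ => ?_
    by_cases hb : (b : ℕ) ≤ i
    · rw [h2 i a (le_trans hab hb), mul_zero]
    · simp [rows, hb]
  have h5 : ∀ a b : Fin k, ∑ i, rows p i b * z i a = 0 := fun a b => by
    rcases le_total a b with hab | hab
    · exact h4 a b hab
    · rw [h3]
      exact h4 b a hab
  have hu := (isUnit_sq p).2 hp
  change z i = 0
  ext a
  refine Fin.addCases (motive := fun i => z i a = 0) (fun i => ?_) (fun i => h2 _ _ ?_) i
  · have : (fun i : Fin k => z (Fin.castAdd r i) a) ᵥ* sq p = 0 := by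
      funext b
      have := h5 a b
      rw [Fin.sum_univ_add, add_eq_left.2] at this
      · simpa [Matrix.vecMul, dotProduct, sq, mul_comm] using this
      · refine Finset.sum_eq_zero fun i _ => ?_
        rw [h2, mul_zero]
        simp
        omega
    have := hu.invertible
    have h0 : (fun i : Fin k => z (Fin.castAdd r i) a) = 0 := by
      have e := congrArg (fun v => v ᵥ* (sq p)⁻¹) ‹_ ᵥ* sq p = 0›
      simpa [Matrix.vecMul_vecMul] using e
    exact congrFun h0 i
  · simp
    omega

theorem exists_hasStrictFDerivAt_qform {C : Type*} [Fintype C] {q k : ℕ}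
    (M : C → Matrix (Fin q) (Fin q) ℝ) (p : Tri q k → ℝ) :
    ∃ G' : (Tri q k → ℝ) →L[ℝ] (C → ℝ),
      HasStrictFDerivAt (fun p c => qform (M c) (rows p)) G' p ∧
      ∀ η c, G' η c = ∑ i, ∑ j, M c i j *
        (inner ℝ (rows p i) (rows η j) + inner ℝ (rows η i) (rows p j)) := by
  refine ⟨ContinuousLinearMap.pi fun c => ∑ i, ∑ j, M c i j •
    (fderivInnerCLM ℝ (rowsL q k i p, rowsL q k j p)).comp ((rowsL q k i).prod (rowsL q k j)),
    hasStrictFDerivAt_pi.2 fun c => ?_, fun η c => ?_⟩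
  · refine HasStrictFDerivAt.fun_sum fun i _ => HasStrictFDerivAt.fun_sum fun j _ => ?_
    exact ((rowsL q k i).hasStrictFDerivAt.inner ℝ (rowsL q k j).hasStrictFDerivAt).const_mul _
  · simp [rowsL_apply, fderivInnerCLM_apply]

/-- A functional vanishing on the range has coefficients l_c for which ∑ l_c M_c is critical at p.
By `sum_smul_rows_eq_zero` this is a linear relation among the tuples M_c p. -/
theorem range_eq_top_of_linearIndependent {C : Type*} [Fintype C] {k r : ℕ}
    {M : C → Matrix (Fin (k + r)) (Fin (k + r)) ℝ} (hM : ∀ c, (M c).IsSymm)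
    {p : Tri (k + r) k → ℝ} (hp : ∀ i, diag p i ≠ 0)
    (hind : LinearIndependent ℝ fun c i => ∑ j, M c i j • rows p j)
    {G' : (Tri (k + r) k → ℝ) →L[ℝ] (C → ℝ)}
    (hG' : ∀ η c, G' η c = ∑ i, ∑ j, M c i j *
        (inner ℝ (rows p i) (rows η j) + inner ℝ (rows η i) (rows p j))) : G'.range = ⊤ := by
  classical
  by_contra hne
  obtain ⟨f, hf, hle⟩ := Submodule.exists_le_ker_of_lt_top _ (lt_top_iff_ne_top.2 hne)
  let l : C → ℝ := fun c => f fun j => if c = j then 1 else 0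
  have hfl : ∀ x, f x = ∑ c, x c * l c := fun x => by
    rw [LinearMap.pi_apply_eq_sum_univ f x]
    rfl
  have key := sum_smul_rows_eq_zero (M := ∑ c, l c • M c) (p := p)
    (by
      rw [Matrix.IsSymm, Matrix.transpose_sum]
      exact Finset.sum_congr rfl fun c _ => by rw [Matrix.transpose_smul, (hM c).eq]) hp
    (fun η => by
      have h0 : f (G' η) = 0 := hle ⟨η, rfl⟩
      rw [hfl] at h0
      rw [← h0]
      simp only [hG', Matrix.sum_apply, Matrix.smul_apply, smul_eq_mul, Finset.sum_mul]
      rw [Finset.sum_comm' (t' := Finset.univ) (s' := fun _ => Finset.univ) (by simp)]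
      rw [Finset.sum_comm]
      conv_rhs => rw [Finset.sum_comm]
      refine Finset.sum_congr rfl fun i _ => ?_
      conv_rhs => rw [Finset.sum_comm]
      refine Finset.sum_congr rfl fun j _ => Finset.sum_congr rfl fun c _ => ?_
      ring)
  have h0 : ∀ c, l c = 0 := Fintype.linearIndependent_iff.1 hind l (by
    funext i
    rw [Finset.sum_apply, Pi.zero_apply, ← key i]
    simp only [Pi.smul_apply, Matrix.sum_apply, Matrix.smul_apply, smul_eq_mul, Finset.sum_smul,
      Finset.smul_sum, smul_smul]
    exact Finset.sum_comm)
  exact hf (LinearMap.ext fun x => by simp [hfl, h0])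

/-! ### The local structure of a quotient cut out by quadratic constraints -/

theorem trank_map {p p' q : ℕ} {f : E p →ₗ[ℝ] E p'} (hf : Function.Injective f) (v : Fin q → E p) :
    trank (f ∘ v) = trank v := by
  rw [trank, Set.range_comp, Submodule.span_image]
  exact LinearEquiv.finrank_eq (Submodule.equivMapOfInjective _ hf _).symm

theorem trank_smul {p q : ℕ} {c : ℝ} (hc : c ≠ 0) (v : Fin q → E p) : trank (c • v) = trank v :=
  trank_map (f := LinearMap.lsmul ℝ _ c) (smul_right_injective _ hc) v

theorem univBall_eq_smul {V : Type*} [NormedAddCommGroup V] [NormedSpace ℝ V] {δ : ℝ}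
    (hδ : 0 < δ) (v : V) : ∃ c : ℝ, c ≠ 0 ∧ univBall (0 : V) δ v = c • v :=
  ⟨_, by positivity, univBall_zero_apply hδ v⟩

/-- `univBall` at 0 rescales by a factor depending only on the norm, and the sup norm of a tuple is
O(e)-invariant. -/
theorem univBall_act {e r : ℕ} {δ : ℝ} (hδ : 0 < δ) {B : Matrix (Fin e) (Fin e) ℝ}
    (hB : B ∈ Matrix.orthogonalGroup (Fin e) ℝ) (w : Fin r → E e) (i : Fin r) :
    univBall (0 : Fin r → E e) δ (fun i => act B (w i)) i =
      act B (univBall (0 : Fin r → E e) δ w i) := by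
  have : ‖fun i => act B (w i)‖ = ‖w‖ := by
    simp only [Pi.norm_def, nnnorm]
    congr 2
    funext i
    exact Subtype.ext (norm_act hB _)
  rw [univBall_zero_apply hδ, univBall_zero_apply hδ, this, Pi.smul_apply, Pi.smul_apply, act_smul]

theorem append_rel {e k r : ℕ} {w w' : Fin r → E e} (h : oSetoid e r w w') :
    oSetoid e (k + r) (Fin.append (fun _ : Fin k => (0 : E e)) w)
      (Fin.append (fun _ : Fin k => (0 : E e)) w') := by
  obtain ⟨B, hB, h⟩ := h
  refine ⟨B, hB, fun i => Fin.addCases (fun i => ?_) (fun i => ?_) i⟩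
  · simp [act_zero]
  · simp [h]

theorem continuous_append {e k r : ℕ} :
    Continuous fun w : Fin r → E e => Fin.append (fun _ : Fin k => (0 : E e)) w := by
  refine continuous_pi fun i => ?_
  induction i using Fin.addCases with
  | left i =>
    simp only [Fin.append_left]
    exact continuous_const
  | right i =>
    simp only [Fin.append_right]
    exact continuous_apply i

/-- The subset of `(ℝ^d)^q / SO(d)` cut out by the quadratic constraints `M i = c i`. -/
def level {C : Type*} {d q : ℕ} (M : C → Matrix (Fin q) (Fin q) ℝ) (c : C → ℝ) :
    Set (VecModSO d q) := {z | ∀ i, qf (M i) z = c i}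

/-- The chart sends (κ, [w]) to the class of `emb (f (κ, w)) (ρ w)`. It is well defined and
injective because f depends on w only through the invariant H and because slice representatives are
unique up to SO(e). -/
theorem exists_chart_emb {C : Type*} [Fintype C] {k e r a : ℕ}
    {M : C → Matrix (Fin (k + r)) (Fin (k + r)) ℝ} (hM : ∀ i, (M i).IsSymm) {c : C → ℝ}
    {p₀ : Tri (k + r) k → ℝ} (hp₀ : Pos e p₀) (hc : ∀ i, qform (M i) (rows p₀) = c i)
    (hind : LinearIndependent ℝ fun c i => ∑ j, M c i j • rows p₀ j)
    (ha : Fintype.card (Tri (k + r) k) = a + Fintype.card C) :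
    ∃ Ψ : E a × VecModSO e r → level (d := k + e) M c, IsOpenEmbedding Ψ ∧
      (Ψ (0, Quotient.mk _ 0)).1 = Quotient.mk _ (emb p₀ 0) ∧
      ∀ x, vrank (Ψ x).1 = k + vrank x.2 := by
  obtain ⟨G', hG, hG'⟩ := exists_hasStrictFDerivAt_qform M p₀
  let H : (Fin r → E e) → C → ℝ :=
    fun w i => qform (M i) (Fin.append (fun _ : Fin k => (0 : E e)) w)
  have hH : Continuous H := continuous_pi fun i => (continuous_qform _).comp continuous_append
  have hH0 : H 0 = 0 := by
    funext i
    have : Fin.append (fun _ : Fin k => (0 : E e)) (0 : Fin r → E e) = 0 := by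
      funext i
      refine Fin.addCases (fun i => ?_) (fun i => ?_) i <;> simp
    simp [H, this, qform]
  have hHrel : ∀ w w', oSetoid e r w w' → H w = H w' := fun w w' h => by
    funext i
    exact qform_eq_of_oSetoid _ (append_rel h)
  obtain ⟨δ, f, hδ, hfc, hf0, hfO, hfinj, hfN⟩ := exists_implicit_chart hG
    (range_eq_top_of_linearIndependent hM hp₀.1 hind hG') hH hH0 (isOpen_pos e) hp₀ (a := a)
    (by simpa using ha)
  have hG0 : (fun i => qform (M i) (rows p₀)) = c := funext hc
  rw [hG0] at hfO hfN
  let ρ : (Fin r → E e) → Fin r → E e := univBall 0 δ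
  have hρc : Continuous ρ := continuous_univBall 0 δ
  have hρinj : Function.Injective ρ := fun w w' h => by
    simpa [ρ] using congrArg (univBall (0 : Fin r → E e) δ).symm h
  have hρact : ∀ {B : Matrix (Fin e) (Fin e) ℝ}, B ∈ Matrix.specialOrthogonalGroup (Fin e) ℝ →
      ∀ w, ρ (fun i => act B (w i)) = fun i => act B (ρ w i) := fun hB w => by
    funext i
    exact univBall_act hδ (Matrix.mem_specialOrthogonalGroup_iff.1 hB).1 w i
  have hρrel : ∀ w w', soSetoid e r w w' → soSetoid e r (ρ w) (ρ w') := by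
    rintro w w' ⟨B, hB, h⟩
    refine ⟨B, hB, fun i => ?_⟩
    rw [← funext h, hρact hB]
  have hρrel' : ∀ w w', soSetoid e r (ρ w) (ρ w') → soSetoid e r w w' := by
    rintro w w' ⟨B, hB, h⟩
    refine ⟨B, hB, fun i => congrFun (hρinj (?_ : ρ (fun i => act B (w i)) = ρ w')) i⟩
    rw [hρact hB]
    exact funext h
  have hHρ : ∀ w w', soSetoid e r w w' → H (ρ w) = H (ρ w') := fun w w' h =>
    hHrel _ _ (oSetoid_of_soSetoid (hρrel _ _ h))
  let Ψ₀ : E a × (Fin r → E e) → level (d := k + e) M c := fun x =>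
    ⟨Quotient.mk _ (emb (f x) (ρ x.2)), fun i => by
      change qform (M i) (emb (f x) (ρ x.2)) = c i
      rw [qform_emb]
      exact congrFun (hfO x).2 i⟩
  have hΨ₀ : Continuous Ψ₀ := Continuous.subtype_mk (continuous_quotient_mk'.comp
    (continuous_emb.comp (hfc.prodMk (hρc.comp continuous_snd)))) _
  have hΨ₀rel : ∀ κ w w', soSetoid e r w w' → Ψ₀ (κ, w) = Ψ₀ (κ, w') := fun κ w w' h => by
    refine Subtype.ext (Quotient.sound ?_)
    change soSetoid _ _ (emb (f (κ, w)) (ρ w)) (emb (f (κ, w')) (ρ w'))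
    rw [(hfinj κ κ w w' (hHρ _ _ h)).2 rfl]
    exact soSetoid_emb _ (hρrel _ _ h)
  let Ψ : E a × VecModSO e r → level (d := k + e) M c := fun x =>
    Quotient.lift (fun w => Ψ₀ (x.1, w)) (hΨ₀rel x.1) x.2
  let π : E a × (Fin r → E e) → E a × VecModSO e r := Prod.map id (Quotient.mk _)
  have hπ : IsOpenQuotientMap π := IsOpenQuotientMap.id.prodMap (isOpenQuotientMap_mk e r)
  have hΨπ : ∀ x, Ψ (π x) = Ψ₀ x := fun x => rfl
  refine ⟨Ψ, .of_continuous_injective_isOpenMap (hπ.continuous_comp_iff.1 hΨ₀) ?_ ?_, ?_, ?_⟩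
  · intro x x' h
    obtain ⟨⟨κ, w⟩, rfl⟩ := hπ.surjective x
    obtain ⟨⟨κ', w'⟩, rfl⟩ := hπ.surjective x'
    obtain ⟨h1, h2⟩ := eq_of_soSetoid_emb (hfO _).1 (hfO _).1 (Quotient.exact (Subtype.ext_iff.1 h))
    have h3 := hρrel' _ _ h2
    exact Prod.ext ((hfinj _ _ _ _ (hHρ _ _ h3)).1 h1) (Quotient.sound h3)
  · intro O hO
    obtain ⟨N, hN, hNiff⟩ := hfN (π ⁻¹' O) (hO.preimage hπ.continuous)
    -- The slice tuples outside N, with the sign condition relaxed so that the set is closed. On the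
    -- invariant open set Q the diagonal entries of slice tuples are nonzero, so the relaxed
    -- condition is the strict one. The image of O is therefore the trace on the level set of the
    -- image of Q minus the saturation of C₁, with no continuity of Gram–Schmidt needed.
    let C₁ : Set (Fin (k + r) → E (k + e)) := {y | emb (projP y) (projW y) = y} ∩
      {y | ∀ i : Fin k, (i : ℕ) + 1 < k + e → 0 ≤ diag (projP y) i} ∩
      (fun y => (projP y, projW y)) ⁻¹' Nᶜ
    have hC₁ : IsClosed C₁ := by
      refine (IsClosed.inter ?_ ?_).inter ?_
      · exact isClosed_eq (continuous_emb.comp (continuous_projP.prodMk continuous_projW))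
          continuous_id
      · simp only [Set.ofPred_forall]
        refine isClosed_iInter fun i => isClosed_iInter fun _ => isClosed_le continuous_const ?_
        exact (continuous_apply _).comp continuous_projP
      · exact hN.isClosed_compl.preimage (continuous_projP.prodMk continuous_projW)
    let Q : Set (Fin (k + r) → E (k + e)) := {y | LinearIndependent ℝ (y ∘ Fin.castAdd r)}
    have hQ : IsOpen Q := isOpen_setOfPred_linearIndependent.preimage
      (f := fun (y : Fin (k + r) → E (k + e)) => y ∘ Fin.castAdd r)
      (continuous_pi fun i => continuous_apply _)
    have key : Ψ '' O = Subtype.val ⁻¹' (Quotient.mk (soSetoid (k + e) (k + r)) ''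
        (Q ∩ {y | ∃ v ∈ C₁, soSetoid _ _ v y}ᶜ)) := by
      ext z
      constructor
      · rintro ⟨x, hx, rfl⟩
        obtain ⟨x, rfl⟩ := hπ.surjective x
        refine ⟨emb (f x) (ρ x.2), ⟨(linearIndependent_emb _ _).2 (hfO x).1.1, ?_⟩, rfl⟩
        rintro ⟨v, ⟨⟨hv1, hv2⟩, hv3⟩, hvx⟩
        simp only [Set.mem_ofPred_eq] at hv1 hv2
        rw [Set.mem_preimage, Set.mem_compl_iff] at hv3
        have hvQ : LinearIndependent ℝ (v ∘ Fin.castAdd r) :=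
          linearIndependent_of_soSetoid ((soSetoid _ _).symm hvx)
            ((linearIndependent_emb _ _).2 (hfO x).1.1)
        rw [← hv1] at hvQ hvx
        have hd := (linearIndependent_emb _ _).1 hvQ
        obtain ⟨h1, h2⟩ := eq_of_soSetoid_emb
          ⟨hd, fun i hi => lt_of_le_of_ne (hv2 i hi) (hd i).symm⟩ (hfO x).1 hvx
        obtain ⟨B, hB, h2⟩ := (soSetoid _ _).symm h2
        have hrel : soSetoid e r x.2 (fun i => act B (x.2 i)) := ⟨B, hB, fun _ => rfl⟩
        let x' : E a × (Fin r → E e) := (x.1, fun i => act B (x.2 i))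
        have hx' : π x' ∈ O := by
          have : π x' = π x := Prod.ext rfl (Quotient.sound ((soSetoid _ _).symm hrel))
          rwa [this]
        have hfx : f x' = projP v := by
          rw [h1]
          exact ((hfinj x.1 x.1 _ _ (hHρ _ _ hrel)).2 rfl).symm
        have hρx : ρ x'.2 = projW v := (hρact hB _).trans (funext h2)
        refine hv3 ((hNiff (projP v) (projW v) ?_).2 ⟨x', hx', hfx, hρx⟩)
        rw [← hfx, ← hρx]
        exact (hfO x').2
      · rintro ⟨y, ⟨hyQ, hyC⟩, hyz⟩
        obtain ⟨p, w, hp, hyp⟩ := exists_emb hyQ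
        have hz : z.1 = Quotient.mk _ (emb p w) := hyz.symm.trans (Quotient.sound hyp)
        have hpN : (p, w) ∈ N := by
          by_contra hpN
          refine hyC ⟨emb p w, ⟨⟨?_, ?_⟩, ?_⟩, (soSetoid _ _).symm hyp⟩
          · simp
          · simpa using fun i hi => (hp.2 i hi).le
          · simpa using hpN
        obtain ⟨x, hx, rfl, rfl⟩ := (hNiff p w (funext fun i => by
          have := z.2 i
          rw [hz] at this
          exact (qform_emb (M i) p w).symm.trans this)).1 hpN
        exact ⟨π x, hx, Subtype.ext hz.symm⟩
    rw [key]
    exact ((isOpenQuotientMap_mk _ _).isOpenMap _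
      (hQ.inter (isClosed_saturation hC₁).isOpen_compl)).preimage continuous_subtype_val
  · change Quotient.mk (soSetoid (k + e) (k + r)) (emb (f (0, 0)) (ρ 0)) = _
    rw [hf0, show ρ 0 = 0 from univBall_apply_zero _ _]
  · intro x
    obtain ⟨x, rfl⟩ := hπ.surjective x
    change trank (emb (f x) (ρ x.2)) = k + trank x.2
    obtain ⟨s, hs, h⟩ := univBall_eq_smul hδ x.2
    rw [trank_emb (hfO x).1.1, show ρ x.2 = s • x.2 from h, trank_smul hs]

/-! ### Reordering -/

/-- Reordering the vectors of a tuple, on the quotient. -/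
def permQ {d q : ℕ} (σ : Equiv.Perm (Fin q)) : VecModSO d q ≃ₜ VecModSO d q where
  toFun := Quotient.map (fun v => v ∘ σ) fun _ _ ⟨A, hA, h⟩ => ⟨A, hA, fun i => h (σ i)⟩
  invFun := Quotient.map (fun v => v ∘ σ.symm) fun _ _ ⟨A, hA, h⟩ => ⟨A, hA, fun i => h (σ.symm i)⟩
  left_inv z := by
    induction z using Quotient.inductionOn
    simp [Function.comp_assoc]
  right_inv z := by
    induction z using Quotient.inductionOn
    simp [Function.comp_assoc]
  continuous_toFun := Continuous.quotient_map' (by fun_prop) _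
  continuous_invFun := Continuous.quotient_map' (by fun_prop) _

theorem qform_perm {d q : ℕ} (M : Matrix (Fin q) (Fin q) ℝ) (σ : Equiv.Perm (Fin q))
    (v : Fin q → E d) : qform (M.submatrix σ σ) (v ∘ σ) = qform M v := by
  unfold qform
  conv_rhs => rw [← Equiv.sum_comp σ]
  refine Finset.sum_congr rfl fun i _ => ?_
  conv_rhs => rw [← Equiv.sum_comp σ]
  rfl

theorem qf_perm {d q : ℕ} (M : Matrix (Fin q) (Fin q) ℝ) (σ : Equiv.Perm (Fin q))
    (z : VecModSO d q) : qf (M.submatrix σ σ) (permQ σ z) = qf M z := by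
  induction z using Quotient.inductionOn
  exact qform_perm M σ _

theorem trank_perm {d q : ℕ} (σ : Equiv.Perm (Fin q)) (v : Fin q → E d) :
    trank (v ∘ σ) = trank v := by
  rw [trank, trank, EquivLike.range_comp]

theorem vrank_perm {d q : ℕ} (σ : Equiv.Perm (Fin q)) (z : VecModSO d q) :
    vrank (permQ σ z) = vrank z := by
  induction z using Quotient.inductionOn
  exact trank_perm σ _

theorem exists_perm_linearIndependent {d k r : ℕ} {y : Fin (k + r) → E d} (hy : trank y = k) :
    ∃ σ : Equiv.Perm (Fin (k + r)), LinearIndependent ℝ ((y ∘ σ) ∘ Fin.castAdd r) := by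
  obtain ⟨ι, g, hg, hspan, hli⟩ := exists_linearIndependent' ℝ y
  have : Fintype ι := Fintype.ofInjective g hg
  have hcard : Fintype.card ι = k := by
    rw [← hy, trank, ← hspan, finrank_span_eq_card hli]
  let s : Fin k ≃ ι := (Fintype.equivFinOfCardEq hcard).symm
  -- Only the first k values matter; this injection of the first k indices is then completed to a
  -- permutation.
  let f : Fin (k + r) → Fin (k + r) := Fin.append (fun i => g (s i)) (Fin.natAdd k)
  have hf : ∀ i, f (Fin.castAdd r i) = g (s i) := fun i => by simp [f]
  have hinj : Set.InjOn f (Set.range (Fin.castAdd r)) := by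
    rintro _ ⟨i, rfl⟩ _ ⟨j, rfl⟩ h
    rw [hf, hf] at h
    rw [s.injective (hg h)]
  obtain ⟨σ, hσ⟩ := Set.MapsTo.exists_equiv_extend_of_card_eq (t := Finset.univ)
    (by simp) (fun _ _ => by simp) hinj
  refine ⟨σ.trans (Equiv.subtypeUnivEquiv (by simp)), ?_⟩
  have : (y ∘ σ.trans (Equiv.subtypeUnivEquiv (by simp))) ∘ Fin.castAdd r = (y ∘ g) ∘ s := by
    funext i
    change y (σ (Fin.castAdd r i)).1 = y (g (s i))
    rw [hσ _ ⟨i, rfl⟩, hf]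
  rw [this]
  exact hli.comp _ s.injective

/-! ### Counting triangular coordinates; the chart at an arbitrary point of rank k -/

/-- The dimension of the space of `q × k` matrices that vanish above the diagonal. -/
def bdim (q k : ℕ) : ℕ := ∑ i ∈ Finset.range k, (q - i)

/-- Counted by columns: column a has its entries in the rows i ≥ a. -/
theorem card_tri (k r : ℕ) : Fintype.card (Tri (k + r) k) = bdim (k + r) k := by
  let s : Tri (k + r) k ≃ Σ a : Fin k, {i : Fin (k + r) // Fin.castAdd r a ≤ i} :=
    { toFun := fun x => ⟨x.1.2, x.1.1, x.2⟩
      invFun := fun x => ⟨(x.2.1, x.1), x.2.2⟩ }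
  rw [Fintype.card_congr s, Fintype.card_sigma, bdim, Finset.sum_range]
  refine Finset.sum_congr rfl fun a _ => ?_
  rw [Fintype.card_subtype]
  have : (Finset.univ.filter fun i => Fin.castAdd r a ≤ i) = Finset.Ici (Fin.castAdd r a) := by
    ext
    simp
  rw [this, Fin.card_Ici]
  simp

/-- Near a point of rank `k` at which the constraints are independent, the quotient cut out by
quadratic constraints is a product of a Euclidean space with a quotient `(ℝ^e)^r / SO(e)`. -/
theorem exists_chart {C : Type*} [Fintype C] {d q k e r a : ℕ}
    {M : C → Matrix (Fin q) (Fin q) ℝ} (hM : ∀ i, (M i).IsSymm) {c : C → ℝ}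
    (hd : d = k + e) (hq : q = k + r) {y : Fin q → E d} (hk : trank y = k)
    (hc : ∀ i, qform (M i) y = c i)
    (hind : LinearIndependent ℝ fun c i => ∑ j, M c i j • y j)
    (ha : bdim q k = a + Fintype.card C) :
    ∃ Ψ : E a × VecModSO e r → level (d := d) M c, IsOpenEmbedding Ψ ∧
      (Ψ (0, Quotient.mk _ 0)).1 = Quotient.mk _ y ∧
      ∀ x, vrank (Ψ x).1 = k + vrank x.2 := by
  subst hd hq
  obtain ⟨σ, hσ⟩ := exists_perm_linearIndependent hk
  obtain ⟨p, w, hp, hyp⟩ := exists_emb hσ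
  -- The triangular part alone accounts for the rank k.
  have hw : w = 0 := by
    have h1 := trank_eq_of_oSetoid (oSetoid_of_soSetoid hyp)
    rw [trank_perm, hk, trank_emb hp.1] at h1
    exact trank_eq_zero.1 (by omega)
  subst hw
  have happ : Fin.append (fun _ : Fin k => (0 : E e)) (0 : Fin r → E e) = 0 := by
    funext i
    refine Fin.addCases (fun i => ?_) (fun i => ?_) i <;> simp
  have hemb : ∀ i, emb p (0 : Fin r → E e) i = cat (rows p i) 0 := fun i => by
    rw [emb, happ]
    rfl
  let M' : C → Matrix (Fin (k + r)) (Fin (k + r)) ℝ := fun i => (M i).submatrix σ σ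
  have hc' : ∀ i, qform (M' i) (rows p) = c i := fun i => by
    rw [← hc i, ← qform_perm (M i) σ y, qform_eq_of_oSetoid _ (oSetoid_of_soSetoid hyp), qform_emb, happ]
    simp [qform, M']
  obtain ⟨A, hA, hyp'⟩ := (soSetoid _ _).symm hyp
  have hind' : LinearIndependent ℝ fun c i => ∑ j, M' c i j • rows p j := by
    let T₁ : E k →ₗ[ℝ] E (k + e) :=
      (Matrix.toEuclideanLin A).comp ((catL k e).comp (LinearMap.inl ℝ _ _))
    -- T undoes the reordering and the rotation into the slice. It carries the family for `rows p`
    -- to the independent family for y, so the former is independent too.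
    let T : (Fin (k + r) → E k) →ₗ[ℝ] (Fin (k + r) → E (k + e)) :=
      LinearMap.pi fun i => T₁.comp (LinearMap.proj (σ.symm i))
    refine LinearIndependent.of_comp T ?_
    convert hind using 1
    funext c i
    have hT : ∀ j, T₁ (rows p j) = y (σ j) := fun j => by
      change act A (cat (rows p j) 0) = _
      rw [← hemb, hyp']
      rfl
    change T₁ (∑ j, M c (σ (σ.symm i)) (σ j) • rows p j) = _
    rw [map_sum, Equiv.apply_symm_apply]
    simp only [map_smul, hT]
    exact Equiv.sum_comp σ fun j => M c i j • y j
  obtain ⟨Ψ, hΨ, h0, hrank⟩ := exists_chart_emb (M := M')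
    (fun i => (hM i).submatrix σ) hp hc' hind' (by rw [card_tri, ha])
  let s : level (d := k + e) M' c ≃ₜ level (d := k + e) M c :=
    (permQ σ).symm.subtype fun z => by
      refine forall_congr' fun i => ?_
      rw [← qf_perm (M i) σ, Homeomorph.apply_symm_apply]
  have hs : ∀ z, permQ σ (s z).1 = z.1 := fun z => (permQ σ).apply_symm_apply _
  refine ⟨s ∘ Ψ, s.isOpenEmbedding.comp hΨ, ?_, fun x => ?_⟩
  · refine (permQ σ).injective ?_
    rw [Function.comp_apply, hs, h0]
    exact Quotient.sound ((soSetoid _ _).symm hyp)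
  · rw [Function.comp_apply, ← vrank_perm σ, hs, hrank]

/-! ### `(ℝ^e)^r / SO(e)` as an open cone -/

theorem qform_one {d q : ℕ} (v : Fin q → E d) : qform 1 v = ∑ i, ‖v i‖ ^ 2 := by
  simp [qform, Matrix.one_apply]

theorem qf_one_nonneg {d q : ℕ} (z : VecModSO d q) : 0 ≤ qf 1 z := by
  induction z using Quotient.inductionOn with | _ v => ?_
  change 0 ≤ qform 1 v
  rw [qform_one]
  positivity

/-- The base point of `(ℝ^d)^q / SO(d)`. -/
def origin (d q : ℕ) : VecModSO d q := Quotient.mk _ 0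

theorem qf_one_eq_zero {d q : ℕ} {z : VecModSO d q} : qf 1 z = 0 ↔ z = origin d q := by
  constructor
  · induction z using Quotient.inductionOn with | _ v => ?_
    intro h
    change qform 1 v = 0 at h
    rw [qform_one, Finset.sum_eq_zero_iff_of_nonneg (fun _ _ => by positivity)] at h
    have : v = 0 := funext fun i => by simpa using h i (Finset.mem_univ i)
    rw [this]
    rfl
  · rintro rfl
    change qform 1 0 = 0
    simp [qform_one]

theorem vrank_eq_zero {d q : ℕ} {z : VecModSO d q} : vrank z = 0 ↔ z = origin d q := by
  constructor
  · induction z using Quotient.inductionOn with | _ v => ?_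
    intro h
    rw [trank_eq_zero.1 h]
    rfl
  · rintro rfl
    exact trank_eq_zero.2 rfl

/-- Scaling on the quotient. -/
def smulQ {d q : ℕ} (t : ℝ) : VecModSO d q → VecModSO d q :=
  Quotient.map (fun v => t • v) fun v w ⟨A, hA, h⟩ => ⟨A, hA, fun i => by
    rw [Pi.smul_apply, act_smul, h, Pi.smul_apply]⟩

theorem continuous_smulQ {d q : ℕ} :
    Continuous fun x : ℝ × VecModSO d q => smulQ x.1 x.2 := by
  rw [← (IsOpenQuotientMap.id.prodMap (isOpenQuotientMap_mk d q)).continuous_comp_iff]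
  exact continuous_quotient_mk'.comp
    (by fun_prop : Continuous fun x : ℝ × (Fin q → E d) => x.1 • x.2)

theorem smulQ_smulQ {d q : ℕ} (s t : ℝ) (z : VecModSO d q) :
    smulQ s (smulQ t z) = smulQ (s * t) z := by
  induction z using Quotient.inductionOn
  simp [smulQ, smul_smul]

theorem one_smulQ {d q : ℕ} (z : VecModSO d q) : smulQ 1 z = z := by
  induction z using Quotient.inductionOn
  simp [smulQ]

theorem zero_smulQ {d q : ℕ} (z : VecModSO d q) : smulQ 0 z = origin d q := by
  induction z using Quotient.inductionOn
  simp [smulQ, origin]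

theorem qf_smulQ {d q : ℕ} (M : Matrix (Fin q) (Fin q) ℝ) (t : ℝ) (z : VecModSO d q) :
    qf M (smulQ t z) = t ^ 2 * qf M z := by
  induction z using Quotient.inductionOn with | _ v => ?_
  change qform M (t • v) = t ^ 2 * qform M v
  simp only [qform, Pi.smul_apply, inner_smul_left, inner_smul_right, Finset.mul_sum,
    RCLike.conj_to_real]
  exact Finset.sum_congr rfl fun _ _ => Finset.sum_congr rfl fun _ _ => by ring

theorem vrank_smulQ {d q : ℕ} {t : ℝ} (ht : t ≠ 0) (z : VecModSO d q) :
    vrank (smulQ t z) = vrank z := by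
  induction z using Quotient.inductionOn
  exact trank_smul ht _

/-- The quotient of the unit sphere of `(ℝ^e)^r` by `SO(e)`. -/
abbrev link (e r : ℕ) : Set (VecModSO e r) := level (fun _ : Unit => 1) fun _ => 1

theorem qf_link {e r : ℕ} (l : link e r) : qf 1 l.1 = 1 := l.2 ()

instance (e r : ℕ) : CompactSpace (link e r) := by
  have hc : IsCompact {v : Fin r → E e | qform 1 v = 1} := by
    refine Metric.isCompact_of_isClosed_isBounded
      (isClosed_eq (continuous_qform _) continuous_const) ?_
    refine (Metric.isBounded_closedBall (x := 0) (r := 1)).subset fun v hv => ?_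
    rw [Set.mem_ofPred_eq, qform_one] at hv
    rw [mem_closedBall_zero_iff, pi_norm_le_iff_of_nonneg zero_le_one]
    intro i
    have : ‖v i‖ ^ 2 ≤ 1 := hv ▸
      Finset.single_le_sum (f := fun i => ‖v i‖ ^ 2) (fun _ _ => by positivity) (Finset.mem_univ i)
    exact (sq_le_one_iff₀ (norm_nonneg _)).1 this
  have : link e r = Quotient.mk _ '' {v : Fin r → E e | qform 1 v = 1} := by
    ext z
    induction z using Quotient.inductionOn with | _ v => ?_
    constructor
    · exact fun h => ⟨v, h (), rfl⟩
    · rintro ⟨w, hw, h⟩ -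
      rw [← h]
      exact hw
  rw [← isCompact_iff_compactSpace, this]
  exact hc.image continuous_quotient_mk'

/-- The radius corresponding to the cone parameter. -/
def rad (t : Set.Ico (0 : ℝ) 1) : ℝ := t / (1 - t)

theorem continuous_rad : Continuous rad := by
  unfold rad
  refine continuous_subtype_val.div (continuous_const.sub continuous_subtype_val) fun t => ?_
  have := t.2.2
  exact (sub_pos.2 this).ne'

theorem rad_nonneg (t : Set.Ico (0 : ℝ) 1) : 0 ≤ rad t :=
  div_nonneg t.2.1 (sub_nonneg.2 t.2.2.le)

theorem rad_eq_zero {t : Set.Ico (0 : ℝ) 1} : rad t = 0 ↔ (t : ℝ) = 0 := by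
  rw [rad, div_eq_zero_iff, or_iff_left (sub_pos.2 t.2.2).ne']

theorem rad_injective : Function.Injective rad := fun s t h => by
  have hs := sub_pos.2 s.2.2
  have ht := sub_pos.2 t.2.2
  rw [rad, rad, div_eq_div_iff hs.ne' ht.ne'] at h
  exact Subtype.ext (by linarith)

/-- The cone parameter of a point. -/
def param {e r : ℕ} (z : VecModSO e r) : Set.Ico (0 : ℝ) 1 :=
  ⟨√(qf 1 z) / (1 + √(qf 1 z)), by positivity, by rw [div_lt_one (by positivity)]; linarith⟩

theorem continuous_param {e r : ℕ} : Continuous (param : VecModSO e r → _) := by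
  refine Continuous.subtype_mk ?_ _
  have h : Continuous fun z : VecModSO e r => √(qf 1 z) := (continuous_qf 1).sqrt
  exact h.div (continuous_const.add h) fun z => by positivity

theorem rad_param {e r : ℕ} (z : VecModSO e r) : rad (param z) = √(qf 1 z) := by
  have : 0 ≤ √(qf 1 z) := Real.sqrt_nonneg _
  simp only [rad, param]
  field_simp
  ring

/-- The map from the cone. -/
def coneMap (e r : ℕ) : OpenCone (link e r) → VecModSO e r :=
  Quot.lift (Sum.elim (fun _ => origin e r) fun x => smulQ (rad x.2) x.1.1) (by
    rintro _ _ ⟨l, t, ht⟩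
    simp only [Sum.elim_inr, Sum.elim_inl]
    rw [rad_eq_zero.2 ht, zero_smulQ])

theorem coneMap_vertex (e r : ℕ) : coneMap e r (OpenCone.vertex _) = origin e r := rfl

theorem coneMap_mk {e r : ℕ} (l : link e r) (t : Set.Ico (0 : ℝ) 1) :
    coneMap e r (Quot.mk _ (.inr (l, t))) = smulQ (rad t) l.1 := rfl

theorem qf_coneMap {e r : ℕ} (l : link e r) (t : Set.Ico (0 : ℝ) 1) :
    qf 1 (coneMap e r (Quot.mk _ (.inr (l, t)))) = rad t ^ 2 := by
  rw [coneMap_mk, qf_smulQ, qf_link, mul_one]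

theorem OpenCone.mk_eq_vertex {L : Type*} (l : L) {t : Set.Ico (0 : ℝ) 1} (ht : (t : ℝ) = 0) :
    (Quot.mk _ (.inr (l, t)) : OpenCone L) = OpenCone.vertex L :=
  Quot.sound (.glue l t ht)

theorem coneMap_eq_origin {e r : ℕ} {x : OpenCone (link e r)} :
    coneMap e r x = origin e r ↔ x = OpenCone.vertex _ := by
  constructor
  · intro h
    induction x using Quot.inductionOn with | _ x => ?_
    rcases x with ⟨⟩ | ⟨l, t⟩
    · rfl
    · refine OpenCone.mk_eq_vertex l (rad_eq_zero.1 ?_)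
      have := qf_coneMap l t
      rw [h, qf_one_eq_zero.2 rfl] at this
      exact pow_eq_zero_iff two_ne_zero |>.1 this.symm
  · rintro rfl
    rfl

theorem coneMap_injective (e r : ℕ) : Function.Injective (coneMap e r) := by
  intro x y h
  by_cases hx : x = OpenCone.vertex _
  · subst hx
    exact (coneMap_eq_origin.1 (h.symm.trans (coneMap_vertex e r))).symm
  by_cases hy : y = OpenCone.vertex _
  · subst hy
    exact coneMap_eq_origin.1 (h.trans (coneMap_vertex e r))
  induction x using Quot.inductionOn with | _ x => ?_
  induction y using Quot.inductionOn with | _ y => ?_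
  rcases x with ⟨⟩ | ⟨l, t⟩
  · exact absurd rfl hx
  rcases y with ⟨⟩ | ⟨l', t'⟩
  · exact absurd rfl hy
  have hr : rad t = rad t' := by
    have := congrArg (qf 1) h
    rw [qf_coneMap, qf_coneMap] at this
    exact (pow_left_inj₀ (rad_nonneg t) (rad_nonneg t') two_ne_zero).1 this
  obtain rfl := rad_injective hr
  have ht : rad t ≠ 0 := fun h0 => hx (OpenCone.mk_eq_vertex l (rad_eq_zero.1 h0))
  have := congrArg (smulQ (rad t)⁻¹) h
  rw [coneMap_mk, coneMap_mk, smulQ_smulQ, smulQ_smulQ, inv_mul_cancel₀ ht, one_smulQ,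
    one_smulQ] at this
  rw [Subtype.ext this]

theorem continuous_coneMap (e r : ℕ) : Continuous (coneMap e r) := by
  refine continuous_quot_lift _ (continuous_const.sumElim ?_)
  exact continuous_smulQ.comp ((continuous_rad.comp continuous_snd).prodMk
    (continuous_subtype_val.comp continuous_fst))

/-- The projection to the unit sphere, away from the origin. -/
def dir {e r : ℕ} (z : {z : VecModSO e r // qf 1 z ≠ 0}) : link e r :=
  ⟨smulQ (√(qf 1 z.1))⁻¹ z.1, fun _ => by
    rw [qf_smulQ, inv_pow, Real.sq_sqrt (qf_one_nonneg _), inv_mul_cancel₀ z.2]⟩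

theorem sqrt_qf_ne_zero {e r : ℕ} {z : VecModSO e r} (hz : qf 1 z ≠ 0) : √(qf 1 z) ≠ 0 :=
  (Real.sqrt_ne_zero (qf_one_nonneg _)).2 hz

theorem continuous_dir {e r : ℕ} : Continuous (dir : {z : VecModSO e r // qf 1 z ≠ 0} → _) := by
  refine Continuous.subtype_mk (continuous_smulQ.comp (Continuous.prodMk ?_ continuous_subtype_val)) _
  exact (((continuous_qf 1).comp continuous_subtype_val).sqrt).inv₀ fun z => sqrt_qf_ne_zero z.2

theorem coneMap_dir {e r : ℕ} (z : {z : VecModSO e r // qf 1 z ≠ 0}) :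
    coneMap e r (Quot.mk _ (.inr (dir z, param z.1))) = z.1 := by
  rw [coneMap_mk, rad_param, dir, smulQ_smulQ, mul_inv_cancel₀ (sqrt_qf_ne_zero z.2), one_smulQ]

theorem coneMap_surjective (e r : ℕ) : Function.Surjective (coneMap e r) := fun z => by
  by_cases hz : qf 1 z = 0
  · exact ⟨OpenCone.vertex _, (qf_one_eq_zero.1 hz).symm⟩
  · exact ⟨_, coneMap_dir ⟨z, hz⟩⟩

/-- Away from the vertex, (`dir`, `param`) is a continuous inverse. At the vertex, compactness of
the link and the tube lemma give one neighbourhood of the parameter 0 that works for all directions.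
-/
theorem isOpenMap_coneMap (e r : ℕ) : IsOpenMap (coneMap e r) := by
  intro O hO
  have hO' : IsOpen {x : link e r × Set.Ico (0 : ℝ) 1 | (Quot.mk _ (.inr x) : OpenCone _) ∈ O} :=
    (hO.preimage continuous_quot_mk).preimage continuous_inr
  have hD : IsOpen {z : VecModSO e r | qf 1 z ≠ 0} := isOpen_ne_fun (continuous_qf 1) continuous_const
  rw [isOpen_iff_mem_nhds]
  rintro _ ⟨x, hx, rfl⟩
  by_cases hz : qf 1 (coneMap e r x) = 0
  · have hx0 := coneMap_eq_origin.1 (qf_one_eq_zero.1 hz)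
    subst hx0
    let t₀ : Set.Ico (0 : ℝ) 1 := ⟨0, le_rfl, zero_lt_one⟩
    obtain ⟨u, v, -, hv, hu0, hv0, huv⟩ := generalized_tube_lemma
      (isCompact_univ (X := link e r)) (isCompact_singleton (x := t₀)) hO' (by
        rintro ⟨l, t⟩ ⟨-, ht⟩
        rw [Set.mem_singleton_iff] at ht
        subst ht
        rw [Set.mem_ofPred_eq, OpenCone.mk_eq_vertex l rfl]
        exact hx)
    refine Filter.mem_of_superset ((hv.preimage continuous_param).mem_nhds (?_ : param _ ∈ v)) ?_
    · have : param (coneMap e r (OpenCone.vertex _)) = t₀ := Subtype.ext (by simp [param, hz, t₀])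
      rw [this]
      exact hv0 rfl
    · intro z hzv
      by_cases hz0 : qf 1 z = 0
      · exact ⟨_, hx, (qf_one_eq_zero.1 hz0).symm⟩
      · exact ⟨_, huv (Set.mk_mem_prod (hu0 (Set.mem_univ (dir ⟨z, hz0⟩))) hzv), coneMap_dir ⟨z, hz0⟩⟩
  · have hW : IsOpen (Subtype.val '' {z : {z : VecModSO e r // qf 1 z ≠ 0} |
        (Quot.mk _ (.inr (dir z, param z.1)) : OpenCone _) ∈ O}) :=
      hD.isOpenMap_subtype_val _
        (hO'.preimage (continuous_dir.prodMk (continuous_param.comp continuous_subtype_val)))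
    refine Filter.mem_of_superset (hW.mem_nhds ⟨⟨_, hz⟩, ?_, rfl⟩) ?_
    · rw [Set.mem_ofPred_eq, coneMap_injective e r (coneMap_dir ⟨_, hz⟩)]
      exact hx
    · rintro _ ⟨z, hz, rfl⟩
      exact ⟨_, hz, coneMap_dir z⟩

/-- `(ℝ^e)^r / SO(e)` is the open cone on the quotient of the unit sphere. -/
def coneHomeo (e r : ℕ) : OpenCone (link e r) ≃ₜ VecModSO e r :=
  (Equiv.ofBijective _ ⟨coneMap_injective e r, coneMap_surjective e r⟩).toHomeomorphOfContinuousOpen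
    (continuous_coneMap e r) (isOpenMap_coneMap e r)

theorem vrank_coneHomeo_eq_zero {e r : ℕ} {x : OpenCone (link e r)} :
    vrank (coneHomeo e r x) = 0 ↔ x = OpenCone.vertex _ :=
  vrank_eq_zero.trans coneMap_eq_origin

/-- Nonzero scaling preserves the rank, so a subcone defined by rank on the link is defined by rank
on the cone; only the vertex, of rank 0, has to be added. -/
theorem mem_sub_iff {e r : ℕ} {P : ℕ → Prop} {x : OpenCone (link e r)} :
    x ∈ OpenCone.sub {l : link e r | P (vrank l.1)} ↔
      vrank (coneHomeo e r x) = 0 ∨ P (vrank (coneHomeo e r x)) := by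
  have key : ∀ (l : link e r) (t : Set.Ico (0 : ℝ) 1), (t : ℝ) ≠ 0 →
      vrank (coneHomeo e r (Quot.mk _ (.inr (l, t)))) = vrank l.1 := fun l t ht =>
    vrank_smulQ (mt rad_eq_zero.1 ht) l.1
  rw [vrank_coneHomeo_eq_zero]
  constructor
  · rintro (h | ⟨l, hl, t, rfl⟩)
    · exact .inl h
    · by_cases ht : (t : ℝ) = 0
      · exact .inl (OpenCone.mk_eq_vertex l ht)
      · exact .inr (by rw [key l t ht]; exact hl)
  · rintro (h | h)
    · exact .inl h
    · induction x using Quot.inductionOn with | _ x => ?_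
      rcases x with ⟨⟩ | ⟨l, t⟩
      · exact .inl rfl
      · by_cases ht : (t : ℝ) = 0
        · exact .inl (OpenCone.mk_eq_vertex l ht)
        · exact .inr ⟨l, by rw [key l t ht] at h; exact h, t, rfl⟩

/-! ### Dimensions -/

theorem bdim_succ (q k : ℕ) : bdim q (k + 1) = bdim q k + (q - k) := Finset.sum_range_succ _ _

theorem bdim_add (q k m : ℕ) : bdim q (k + m) = bdim q k + bdim (q - k) m := by
  simp only [bdim, Finset.sum_range_add, Nat.sub_sub]

theorem bdim_mono (q : ℕ) : Monotone (bdim q) :=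
  monotone_nat_of_le_succ fun k => by rw [bdim_succ]; omega

/-- The columns m and m + 1 contribute at least 2 + 1 entries. Thus singular strata have codimension
at least 3. -/
theorem bdim_add_three_le {q d m : ℕ} (hm : m + 2 ≤ d) (hd : d ≤ q) :
    bdim q m + 3 ≤ bdim q d := by
  refine le_trans ?_ (bdim_mono q hm)
  rw [bdim_succ, bdim_succ]
  omega

/-! ### Density of tuples of maximal rank -/

theorem exists_trank_eq {e r : ℕ} (h : e ≤ r) : ∃ v : Fin r → E e, trank v = e := by
  refine ⟨fun i => if hi : (i : ℕ) < e then EuclideanSpace.single ⟨i, hi⟩ 1 else 0, ?_⟩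
  have : Submodule.span ℝ (Set.range fun i : Fin r => if hi : (i : ℕ) < e then
      (EuclideanSpace.single ⟨i, hi⟩ 1 : E e) else 0) = ⊤ := by
    rw [eq_top_iff, ← (EuclideanSpace.basisFun (Fin e) ℝ).toBasis.span_eq, Submodule.span_le]
    rintro _ ⟨a, rfl⟩
    refine Submodule.subset_span ⟨Fin.castLE h a, ?_⟩
    simp
  rw [trank, this]
  simp

theorem vrank_le {d q : ℕ} (z : VecModSO d q) : vrank z ≤ d := by
  induction z using Quotient.inductionOn
  exact trank_le _

theorem isClosed_vrank_le {d q m : ℕ} (hm : m < d) : IsClosed {z : VecModSO d q | vrank z ≤ m} :=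
  range_vecIncl (q := q) hm ▸ (isClosedEmbedding_vecIncl q hm).isClosed_range

/-! ### Ingredients for the regular stratum -/

/-- If `e ≤ 1` then `SO(e)` is trivial. -/
def vecModSOHomeo {e : ℕ} (r : ℕ) (he : e ≤ 1) : (Fin r → E e) ≃ₜ VecModSO e r :=
  (Equiv.ofBijective (Quotient.mk (soSetoid e r)) ⟨fun v w h => by
    obtain ⟨A, hA, h⟩ := Quotient.exact h
    rw [Matrix.mem_specialOrthogonalGroup_iff] at hA
    have h1 : A = 1 := by
      interval_cases e
      · exact Subsingleton.elim _ _
      · ext i j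
        have := hA.2
        rw [Matrix.det_fin_one] at this
        rw [Subsingleton.elim i 0, Subsingleton.elim j 0, this, Matrix.one_apply_eq]
    funext i
    rw [← h i, h1, act_one], Quotient.mk_surjective⟩).toHomeomorphOfContinuousOpen
      (isOpenQuotientMap_mk e r).continuous (isOpenQuotientMap_mk e r).isOpenMap

theorem OpenCone.eq_vertex_of_isEmpty {L : Type*} [IsEmpty L] (x : OpenCone L) :
    x = OpenCone.vertex L := by
  induction x using Quot.inductionOn with | _ x => ?_
  rcases x with ⟨⟩ | ⟨l, -⟩
  · rfl
  · exact isEmptyElim l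

/-- The open cone on the empty space is a point. -/
def OpenCone.homeoUnit (L : Type*) [TopologicalSpace L] [IsEmpty L] : OpenCone L ≃ₜ Unit where
  toFun _ := ()
  invFun _ := OpenCone.vertex L
  left_inv x := (OpenCone.eq_vertex_of_isEmpty x).symm
  right_inv _ := rfl
  continuous_toFun := continuous_const
  continuous_invFun := continuous_const

/-! ### Quotients cut out by quadratic constraints as stratified pseudomanifolds -/

/-- The filtration by rank, indexed by dimension: the stratum of rank `m` has dimension
`bdim q m - C`. -/
def rankFiltration (N C : ℕ) {d q : ℕ} (X : Set (VecModSO d q)) (j : ℕ) : Set X :=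
  {z | N ≤ j ∨ ∃ m, m + 2 ≤ d ∧ bdim q m ≤ j + C ∧ vrank z.1 ≤ m}

/-- The induction step. The stratum of rank k ≤ d - 2 has dimension `bdim q k - card C`, and its
link is the sphere quotient for (e, r) = (d - k, q - k), covered by `hlink`. The lower bound k₀ on
the rank, with `hC`, keeps these natural number subtractions from truncating. -/
theorem isStratifiedPseudomanifold_level_of_link {C : Type*} [Fintype C] {d q k₀ N : ℕ}
    {M : C → Matrix (Fin q) (Fin q) ℝ} (hM : ∀ i, (M i).IsSymm) {c : C → ℝ}
    (hdq : d ≤ q) (hk₀ : 1 ≤ k₀) [CompactSpace (level (d := d) M c)]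
    (hreg : ∀ y : Fin q → E d, (∀ i, qform (M i) y = c i) →
      k₀ ≤ trank y ∧ LinearIndependent ℝ fun c i => ∑ j, M c i j • y j)
    (hC : Fintype.card C ≤ bdim q k₀) (hN : bdim q d = N + Fintype.card C)
    (hlink : ∀ e r, e < d → 2 ≤ e → e ≤ r → IsStratifiedPseudomanifold (bdim r e - 1) (link e r)
      (rankFiltration (bdim r e - 1) 1 (link e r))) :
    IsStratifiedPseudomanifold N (level (d := d) M c)
      (rankFiltration N (Fintype.card C) (level (d := d) M c)) := by
  have hk : ∀ z : level (d := d) M c, k₀ ≤ vrank z.1 := by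
    rintro ⟨z, hz⟩
    induction z using Quotient.inductionOn with | _ y => ?_
    exact (hreg y hz).1
  have hchart : ∀ (z : level (d := d) M c) (k a : ℕ), vrank z.1 = k →
      bdim q k = a + Fintype.card C → ∃ Ψ : E a × VecModSO (d - k) (q - k) → level (d := d) M c,
        IsOpenEmbedding Ψ ∧ Ψ (0, origin _ _) = z ∧ ∀ x, vrank (Ψ x).1 = k + vrank x.2 := by
    rintro ⟨z, hz⟩ k a hzk ha
    have := vrank_le z
    rw [show vrank z = k from hzk] at this
    induction z using Quotient.inductionOn with | _ y => ?_
    obtain ⟨Ψ, h1, h2, h3⟩ := exists_chart hM (show d = k + (d - k) by omega)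
      (show q = k + (q - k) by omega) (y := y) hzk hz (hreg y hz).2 ha
    exact ⟨Ψ, h1, Subtype.ext h2, h3⟩
  have hCk : ∀ z : level (d := d) M c, Fintype.card C ≤ bdim q (vrank z.1) := fun z =>
    hC.trans (bdim_mono q (hk z))
  rw [IsStratifiedPseudomanifold]
  refine ⟨inferInstance, inferInstance, fun j => ?_, ?_, ?_, ?_, ?_, ?_⟩
  · by_cases hj : N ≤ j
    · convert isClosed_univ
      ext z
      simp [rankFiltration, hj]
    · have : rankFiltration N (Fintype.card C) (level (d := d) M c) j =
          ⋃ m ∈ {m | m + 2 ≤ d ∧ bdim q m ≤ j + Fintype.card C},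
            {z : level (d := d) M c | vrank z.1 ≤ m} := by
        ext z
        simp only [rankFiltration, hj, false_or, Set.mem_ofPred_eq, Set.mem_iUnion, exists_prop,
          and_assoc]
      rw [this]
      refine Set.Finite.isClosed_biUnion ?_ fun m hm => ?_
      · exact (Set.finite_lt_nat d).subset fun m hm => by
          have := hm.1
          change m < d
          omega
      · exact (isClosed_vrank_le (by have := hm.1; omega)).preimage continuous_subtype_val
  · rintro j j' hjj z (hz | ⟨m, h1, h2, h3⟩)
    · exact .inl (hz.trans hjj)
    · exact .inr ⟨m, h1, by omega, h3⟩
  · ext z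
    simp [rankFiltration]
  · rintro j hj z (hz | ⟨m, h1, h2, h3⟩)
    · omega
    · have := bdim_add_three_le h1 hdq
      have := (hCk z).trans (bdim_mono q h3)
      exact ⟨bdim q m - Fintype.card C, by omega, .inr ⟨m, h1, by omega, h3⟩⟩
  · intro z
    by_cases hz : vrank z.1 + 2 ≤ d
    swap
    · refine subset_closure ?_
      rintro ⟨j', hj', h | ⟨m, h1, h2, h3⟩⟩ <;> omega
    obtain ⟨Ψ, h1, h2, h3⟩ := hchart z _ (bdim q (vrank z.1) - Fintype.card C) rfl
      (by have := hCk z; omega)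
    -- Scaling a transverse tuple of full rank d - k to zero in the chart exhibits z as a limit of
    -- points of rank d.
    obtain ⟨v, hv⟩ := exists_trank_eq (show d - vrank z.1 ≤ q - vrank z.1 by omega)
    have hlim : Filter.Tendsto (fun t : ℝ => Ψ (0, smulQ t (Quotient.mk _ v))) (𝓝[≠] 0) (𝓝 z) := by
      have hc : Continuous fun t : ℝ => Ψ (0, smulQ t (Quotient.mk _ v)) :=
        h1.continuous.comp (continuous_const.prodMk
          (continuous_smulQ.comp (continuous_id.prodMk continuous_const)))
      have := hc.tendsto 0
      rw [zero_smulQ, h2] at this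
      exact this.mono_left nhdsWithin_le_nhds
    refine mem_closure_of_tendsto hlim ?_
    filter_upwards [self_mem_nhdsWithin] with t ht
    have hr : vrank (Ψ (0, smulQ t (Quotient.mk _ v))).1 = d := by
      rw [h3, vrank_smulQ ht, vrank_mk, hv]
      omega
    rintro ⟨j', hj', h | ⟨m, h4, h5, h6⟩⟩ <;> omega
  · intro i hi p hp hpj
    by_cases hpk : vrank p.1 + 2 ≤ d
    · obtain ⟨k, hkp⟩ : ∃ k, vrank p.1 = k := ⟨_, rfl⟩
      have hCp := hCk p
      have hkp0 := hk p
      rw [hkp] at hpk hCp hkp0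
      have h3 := bdim_add_three_le hpk hdq
      -- A point first enters the filtration at the dimension of its own rank stratum, so minimality
      -- determines i.
      have hik : bdim q k = i + Fintype.card C := by
        have h1 : ¬ bdim q k - Fintype.card C < i := fun h =>
          hpj _ h (.inr ⟨k, hpk, by omega, hkp.le⟩)
        rcases hp with hp | ⟨m, h4, h5, h6⟩
        · omega
        · have := bdim_mono q (hkp ▸ h6)
          omega
      obtain ⟨Ψ, hΨ, hΨ0, hrank⟩ := hchart p k i hkp hik
      -- The second summand is the codimension of the stratum, hence one more than the dimension of
      -- its link.
      have hsum : bdim q d = bdim q k + bdim (q - k) (d - k) := by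
        rw [← bdim_add]
        congr
        omega
      refine ⟨Set.range Ψ, link (d - k) (q - k), inferInstance,
        rankFiltration (bdim (q - k) (d - k) - 1) 1 (link (d - k) (q - k)),
        ((Homeomorph.refl _).prodCongr (coneHomeo _ _)).trans hΨ.isEmbedding.toHomeomorph,
        hΨ.isOpen_range, ⟨_, hΨ0⟩, inferInstance, fun h => by omega, fun h => ?_, fun j hj => ?_,
        fun z => ?_, fun j z => ?_⟩
      · rw [show N - i - 1 = bdim (q - k) (d - k) - 1 by omega]
        exact hlink _ _ (by omega) (by omega) (by omega)
      · rw [Set.eq_empty_iff_forall_notMem]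
        rintro _ ⟨⟨x, rfl⟩, h | ⟨m, h4, h5, h6⟩⟩
        · omega
        · rw [hrank] at h6
          have := bdim_mono q (show k ≤ m by omega)
          omega
      · have hz : vrank (Ψ (z.1, coneHomeo _ _ z.2)).1 = k + vrank (coneHomeo _ _ z.2) := hrank _
        rw [← vrank_coneHomeo_eq_zero]
        change Ψ (z.1, coneHomeo _ _ z.2) ∈ rankFiltration _ _ _ _ ↔ _
        constructor
        · rintro (h | ⟨m, h4, h5, h6⟩)
          · omega
          · by_contra h0
            have h7 := bdim_mono q (show k + 1 ≤ m by omega)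
            rw [bdim_succ] at h7
            omega
        · intro h0
          exact .inr ⟨k, hpk, by omega, by omega⟩
      · have hz : vrank (Ψ (z.1, coneHomeo _ _ z.2)).1 = k + vrank (coneHomeo _ _ z.2) := hrank _
        change Ψ (z.1, coneHomeo _ _ z.2) ∈ rankFiltration _ _ _ _ ↔ _
        refine Iff.trans ?_ (mem_sub_iff (P := fun n => bdim (q - k) (d - k) - 1 ≤ j ∨
          ∃ m, m + 2 ≤ d - k ∧ bdim (q - k) m ≤ j + 1 ∧ n ≤ m)).symm
        simp only [rankFiltration, Set.mem_ofPred_eq, hz]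
        constructor
        · rintro (h | ⟨m, h4, h5, h6⟩)
          · right; left
            omega
          · right; right
            obtain ⟨m', rfl⟩ := Nat.exists_eq_add_of_le (show k ≤ m by omega)
            rw [bdim_add] at h5
            exact ⟨m', by omega, by omega, by omega⟩
        · rintro (h | h | ⟨m, h4, h5, h6⟩)
          · exact .inr ⟨k, hpk, by omega, by omega⟩
          · left
            omega
          · refine .inr ⟨k + m, by omega, ?_, by omega⟩
            rw [bdim_add]
            omega
    · have hd := vrank_le p.1
      have hiN : i = N := by
        rcases hp with hp | ⟨m, h4, h5, h6⟩ <;> omega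
      subst hiN
      obtain ⟨k, hkp⟩ : ∃ k, vrank p.1 = k := ⟨_, rfl⟩
      have hCp := hCk p
      rw [hkp] at hpk hCp hd
      obtain ⟨Ψ, hΨ, hΨ0, hrank⟩ := hchart p k (bdim q k - Fintype.card C) hkp (by omega)
      have hsum : bdim q d = bdim q k + bdim (q - k) (d - k) := by
        rw [← bdim_add]
        congr
        omega
      -- Here d - k ≤ 1, so the acting group is trivial and the chart is a Euclidean space; this
      -- counts its dimension as N.
      have hone : bdim (q - k) (d - k) = (q - k) * (d - k) := by
        rcases (show d - k = 0 ∨ d - k = 1 by omega) with h | h <;> simp [h, bdim]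
      let s : E i ≃L[ℝ] E (bdim q k - Fintype.card C) × (Fin (q - k) → E (d - k)) :=
        ContinuousLinearEquiv.ofFinrankEq (by
          simp only [Module.finrank_prod, Module.finrank_pi_fintype, finrank_euclideanSpace_fin,
            Finset.sum_const, Finset.card_univ, Fintype.card_fin, smul_eq_mul]
          omega)
      let φ : E i × OpenCone Empty ≃ₜ Set.range Ψ :=
        ((((Homeomorph.refl _).prodCongr (OpenCone.homeoUnit Empty)).trans
          (Homeomorph.prodUnique _ _)).trans s.toHomeomorph).trans
          (((Homeomorph.refl _).prodCongr (vecModSOHomeo _ (by omega))).trans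
            hΨ.isEmbedding.toHomeomorph)
      have huniv : ∀ j (x : level (d := d) M c), i ≤ j → x ∈ rankFiltration i (Fintype.card C)
        (level (d := d) M c) j := fun j x hj => .inl hj
      refine ⟨Set.range Ψ, Empty, inferInstance, fun _ => ∅, φ, hΨ.isOpen_range, ⟨_, hΨ0⟩,
        inferInstance, fun _ => inferInstance, fun h => absurd h (lt_irrefl _), fun j hj => ?_,
        fun z => ?_, fun j z => ?_⟩
      · rw [Set.eq_empty_iff_forall_notMem]
        rintro _ ⟨⟨x, rfl⟩, h | ⟨m, h4, h5, h6⟩⟩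
        · omega
        · rw [hrank] at h6
          omega
      · exact iff_of_true (huniv _ _ le_rfl) (OpenCone.eq_vertex_of_isEmpty _)
      · exact iff_of_true (huniv _ _ (by omega)) (.inl (OpenCone.eq_vertex_of_isEmpty _))

/-- The links occurring in a sphere quotient are sphere quotients for smaller e, so strong induction
on e closes. For the single constraint M = 1, regularity at y only means y ≠ 0, which also gives k₀
= 1. -/
theorem isStratifiedPseudomanifold_link {e r : ℕ} (he : 2 ≤ e) (her : e ≤ r) :
    IsStratifiedPseudomanifold (bdim r e - 1) (link e r)
      (rankFiltration (bdim r e - 1) 1 (link e r)) := by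
  induction e using Nat.strong_induction_on generalizing r with | _ e ih => ?_
  have h1 : bdim r 1 = r := by simp [bdim]
  have h2 := bdim_mono r (show 1 ≤ e by omega)
  refine isStratifiedPseudomanifold_level_of_link (fun _ => Matrix.isSymm_one) her le_rfl
    (fun y hy => ?_) (by simp; omega) (by simp; omega) fun e' r' h h' h'' => ih e' h h' h''
  have hy0 : y ≠ 0 := by
    rintro rfl
    have := hy ()
    simp [qform_one] at this
  constructor
  · have : trank y ≠ 0 := mt trank_eq_zero.1 hy0
    omega
  · have : (fun (_ : Unit) i => ∑ j, (1 : Matrix (Fin r) (Fin r) ℝ) i j • y j) = fun _ => y := by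
      funext _ i
      simp [Matrix.one_apply]
    rw [this, linearIndependent_unique_iff]
    exact hy0

theorem isStratifiedPseudomanifold_level {C : Type*} [Fintype C] {d q k₀ N : ℕ}
    {M : C → Matrix (Fin q) (Fin q) ℝ} (hM : ∀ i, (M i).IsSymm) {c : C → ℝ}
    (hdq : d ≤ q) (hk₀ : 1 ≤ k₀) [CompactSpace (level (d := d) M c)]
    (hreg : ∀ y : Fin q → E d, (∀ i, qform (M i) y = c i) →
      k₀ ≤ trank y ∧ LinearIndependent ℝ fun c i => ∑ j, M c i j • y j)
    (hC : Fintype.card C ≤ bdim q k₀) (hN : bdim q d = N + Fintype.card C) :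
    IsStratifiedPseudomanifold N (level (d := d) M c)
      (rankFiltration N (Fintype.card C) (level (d := d) M c)) :=
  isStratifiedPseudomanifold_level_of_link hM hdq hk₀ hreg hC hN fun _ _ _ he her =>
    isStratifiedPseudomanifold_link he her

theorem IsStratifiedPseudomanifold.of_homeomorph {N : ℕ} {X Y : Type} [TopologicalSpace X]
    [TopologicalSpace Y] {F : ℕ → Set X} (h : IsStratifiedPseudomanifold N X F) (s : Y ≃ₜ X) :
    IsStratifiedPseudomanifold N Y fun j => s ⁻¹' F j := by
  rw [IsStratifiedPseudomanifold] at h ⊢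
  obtain ⟨h1, h2, h3, h4, h5, h6, h7, h8⟩ := h
  refine ⟨s.symm.t2Space, s.isClosedEmbedding.paracompactSpace, fun j => (h3 j).preimage s.continuous,
    fun j j' hj => Set.preimage_mono (h4 hj), by simp only [h5, Set.preimage_univ],
    fun j hj y hy => h6 j hj hy, ?_, fun i hi p hp hpj => ?_⟩
  · exact h7.preimage s.isOpenMap
  · obtain ⟨U, L, tL, G, φ, hU, hpU, hc, hE, hL, hj, hv, hs⟩ := h8 i hi (s p) hp hpj
    refine ⟨s ⁻¹' U, L, tL, G, φ.trans (s.symm.image U |>.trans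
      (Homeomorph.setCongr (s.symm.image_eq_preimage_symm U))), hU.preimage s.continuous, hpU, hc,
      hE, hL, fun j hji => ?_, fun z => ?_, fun j z => ?_⟩
    · rw [← Set.preimage_inter, hj j hji, Set.preimage_empty]
    · refine Iff.trans ?_ (hv z)
      change s (s.symm (φ z)) ∈ F i ↔ _
      rw [s.apply_symm_apply]
    · refine Iff.trans ?_ (hs j z)
      change s (s.symm (φ z)) ∈ F (i + j + 1) ↔ _
      rw [s.apply_symm_apply]

/-! ### Dimension formulas -/

theorem two_mul_bdim (k s : ℕ) : 2 * bdim (k + s) k = k * (k + 1) + 2 * k * s := by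
  induction k generalizing s with
  | zero => simp [bdim]
  | succ k ih =>
    rw [bdim_succ, show k + 1 + s = k + (s + 1) by ring, mul_add, ih, Nat.add_sub_cancel_left]
    ring

/-- With q = n - 1: the triangular coordinates number a_k plus the n constraints. -/
theorem bdim_eq_stratumDim {q k : ℕ} (h2 : 2 ≤ k) (hk : k ≤ q) :
    bdim q k = stratumDim (q + 1) k + (q + 1) := by
  obtain ⟨j, rfl⟩ := Nat.exists_eq_add_of_le h2
  obtain ⟨s, rfl⟩ := Nat.exists_eq_add_of_le hk
  have h := two_mul_bdim (2 + j) s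
  have ht : 2 * ((2 + j) * (2 + j - 1) / 2) = (2 + j) * (2 + j - 1) :=
    Nat.mul_div_cancel' (Nat.even_mul_pred_self _).two_dvd
  rw [stratumDim]
  rw [show 2 + j - 1 = j + 1 by omega, show 2 + j + s + 1 - (2 + j) - 1 = s by omega] at *
  generalize (2 + j) * (j + 1) / 2 = t at *
  -- Keeps the final - 1 in `stratumDim` from truncating.
  have : 1 ≤ t := by nlinarith
  have h3 : t + s * (j + 1) - 1 + 1 = t + s * (j + 1) := by omega
  nlinarith

theorem bdim_eq_moduliDim {q d : ℕ} (h2 : 2 ≤ d) (hd : d ≤ q) :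
    bdim q d = moduliDim (q + 1) d + (q + 1) := by
  obtain ⟨j, rfl⟩ := Nat.exists_eq_add_of_le h2
  obtain ⟨s, rfl⟩ := Nat.exists_eq_add_of_le hd
  have h := two_mul_bdim (2 + j) s
  have ht : 2 * (j * (j - 1) / 2) = j * (j - 1) :=
    Nat.mul_div_cancel' (Nat.even_mul_pred_self _).two_dvd
  rw [moduliDim, show 2 + j - 1 = j + 1 by omega, show 2 + j + s + 1 - 3 = j + s by omega,
    show 2 + j - 2 = j by omega, show 2 + j - 3 = j - 1 by omega]
  generalize j * (j - 1) / 2 = t at *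
  -- Keeps the subtraction in `moduliDim` from truncating.
  have h3 : t ≤ (j + s) * (j + 1) := by
    rcases j with _ | j
    · simp at ht
      omega
    · simp only [Nat.add_sub_cancel] at ht
      nlinarith
  obtain ⟨u, hu⟩ := Nat.exists_eq_add_of_le h3
  rw [hu, Nat.add_sub_cancel_left]
  rcases j with _ | j
  · simp at ht
    subst ht
    nlinarith
  · simp only [Nat.add_sub_cancel] at ht
    nlinarith

/-! ### The natural maps of moduli spaces -/

theorem rank_mk {d n : ℕ} {ℓ : Fin n → ℝ} (x : Config d ℓ) :
    rank (Quotient.mk _ x : ModuliM d ℓ) = trank x.1 := rfl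

theorem range_inclNM {m d n : ℕ} (ℓ : Fin n → ℝ) (hmd : m < d) :
    Set.range (inclNM ℓ hmd) = {x | rank x ≤ m} := by
  ext x
  constructor
  · rintro ⟨y, rfl⟩
    induction y using Quotient.inductionOn with | _ u => ?_
    change trank (fun i => pad d (u.1 i)) ≤ m
    rw [trank_pad hmd.le]
    exact trank_le _
  · induction x using Quotient.inductionOn with | _ x => ?_
    intro hx
    obtain ⟨u, hu⟩ := exists_pad_of_trank_le hmd hx
    obtain ⟨A, hA, h⟩ := (soSetoid d n).symm hu
    replace h : ∀ i, act A (x.1 i) = pad d (u i) := h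
    have hu1 : ∀ i, ‖u i‖ = 1 := fun i => by
      rw [← norm_pad hmd.le, ← h i, norm_act (Matrix.mem_specialOrthogonalGroup_iff.1 hA).1, x.2.1]
    have hu2 : ∑ i, ℓ i • u i = 0 := by
      rw [← norm_eq_zero, ← norm_pad hmd.le, ← pad_sum_smul]
      simp only [← h]
      rw [← act_sum_smul, x.2.2, act_zero, norm_zero]
    exact ⟨Quotient.mk _ ⟨u, hu1, hu2⟩, Quotient.sound hu⟩

theorem inclNM_injective {m d n : ℕ} (ℓ : Fin n → ℝ) (hmd : m < d) :
    Function.Injective (inclNM ℓ hmd) := by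
  intro x y
  induction x using Quotient.inductionOn with | _ x => ?_
  induction y using Quotient.inductionOn with | _ y => ?_
  intro h
  have h : soSetoid d n (fun i => pad d (x.1 i)) (fun i => pad d (y.1 i)) :=
    Quotient.exact (s := (soSetoid d n).comap (Subtype.val : Config d ℓ → _)) h
  exact Quotient.sound (oSetoid_of_pad hmd h)

theorem continuous_inclNM {m d n : ℕ} (ℓ : Fin n → ℝ) (hmd : m < d) :
    Continuous (inclNM ℓ hmd) := by
  have h : Continuous fun (x : Config m ℓ) (i : Fin n) => pad d (x.1 i) :=
    continuous_pi fun i => continuous_pad.comp ((continuous_apply i).comp continuous_subtype_val)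
  exact isQuotientMap_quotient_mk'.continuous_iff.2 (continuous_quotient_mk'.comp (h.subtype_mk _))

instance {d n : ℕ} (ℓ : Fin n → ℝ) : CompactSpace (Config d ℓ) := by
  refine isCompact_iff_compactSpace.1 (Metric.isCompact_of_isClosed_isBounded ?_ ?_)
  · refine IsClosed.inter (s₁ := {x : Fin n → E d | ∀ i, ‖x i‖ = 1})
      (s₂ := {x | ∑ i, ℓ i • x i = 0}) ?_ ?_
    · simp only [Set.ofPred_forall]
      exact isClosed_iInter fun i => isClosed_eq (by fun_prop) continuous_const
    · exact isClosed_eq (by fun_prop) continuous_const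
  · refine (Metric.isBounded_closedBall (x := 0) (r := 1)).subset fun x hx => ?_
    rw [mem_closedBall_zero_iff, pi_norm_le_iff_of_nonneg zero_le_one]
    exact fun i => (hx.1 i).le

/-! ### Moduli spaces as quotients cut out by quadratic constraints -/

/-- The quadratic constraints on a configuration without its last vector. -/
def linkM {q : ℕ} (ℓ : Fin (q + 1) → ℝ) : Option (Fin q) → Matrix (Fin q) (Fin q) ℝ
  | none => Matrix.vecMulVec (fun i => ℓ i.castSucc) (fun i => ℓ i.castSucc)
  | some i => Matrix.single i i 1

/-- The values of the quadratic constraints. -/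
def linkC {q : ℕ} (ℓ : Fin (q + 1) → ℝ) : Option (Fin q) → ℝ
  | none => ℓ (Fin.last q) ^ 2
  | some _ => 1

theorem linkM_isSymm {q : ℕ} (ℓ : Fin (q + 1) → ℝ) (i : Option (Fin q)) : (linkM ℓ i).IsSymm := by
  cases i
  · ext a b
    simp [linkM, Matrix.vecMulVec_apply, mul_comm]
  · simp [linkM, Matrix.IsSymm]

theorem qform_linkM_none {d q : ℕ} (ℓ : Fin (q + 1) → ℝ) (y : Fin q → E d) :
    qform (linkM ℓ none) y = ‖∑ i, ℓ i.castSucc • y i‖ ^ 2 := by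
  rw [← real_inner_self_eq_norm_sq]
  simp only [qform, linkM, Matrix.vecMulVec_apply, sum_inner, inner_sum, inner_smul_left,
    inner_smul_right, RCLike.conj_to_real, Finset.mul_sum]
  rw [Finset.sum_comm]
  exact Finset.sum_congr rfl fun _ _ => Finset.sum_congr rfl fun _ _ => by ring

theorem qform_linkM_some {d q : ℕ} (ℓ : Fin (q + 1) → ℝ) (y : Fin q → E d) (i : Fin q) :
    qform (linkM ℓ (some i)) y = ‖y i‖ ^ 2 := by
  rw [← real_inner_self_eq_norm_sq, qform, Finset.sum_eq_single i, Finset.sum_eq_single i]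
  · simp [linkM]
  · intro j _ hj
    simp [linkM, hj.symm]
  · simp
  · intro j _ hj
    simp [linkM, hj.symm]
  · simp

theorem constraints_iff {d q : ℕ} {ℓ : Fin (q + 1) → ℝ} (hℓ : ∀ i, 0 < ℓ i) {y : Fin q → E d} :
    (∀ i, qform (linkM ℓ i) y = linkC ℓ i) ↔
      (∀ i, ‖y i‖ = 1) ∧ ‖∑ i, ℓ i.castSucc • y i‖ = ℓ (Fin.last q) := by
  rw [Option.forall, qform_linkM_none, and_comm]
  simp only [qform_linkM_some, linkC]
  refine and_congr (forall_congr' fun i => ?_) ?_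
  · exact pow_eq_one_iff_of_nonneg (norm_nonneg _) two_ne_zero
  · exact sq_eq_sq₀ (norm_nonneg _) (hℓ _).le

theorem smul_last {d q : ℕ} {ℓ : Fin (q + 1) → ℝ} (x : Config d ℓ) :
    ℓ (Fin.last q) • x.1 (Fin.last q) = -∑ i : Fin q, ℓ i.castSucc • x.1 i.castSucc := by
  have := x.2.2
  rw [Fin.sum_univ_castSucc] at this
  exact (neg_eq_of_add_eq_zero_right this).symm

theorem last_eq {d q : ℕ} {ℓ : Fin (q + 1) → ℝ} (hℓ : ∀ i, 0 < ℓ i) (x : Config d ℓ) :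
    x.1 (Fin.last q) = -(ℓ (Fin.last q))⁻¹ • ∑ i : Fin q, ℓ i.castSucc • x.1 i.castSucc := by
  rw [neg_smul, ← smul_neg, ← smul_last, smul_smul, inv_mul_cancel₀ (hℓ _).ne', one_smul]

theorem constraints_of_config {d q : ℕ} {ℓ : Fin (q + 1) → ℝ} (hℓ : ∀ i, 0 < ℓ i)
    (x : Config d ℓ) (i : Option (Fin q)) :
    qform (linkM ℓ i) (fun i => x.1 i.castSucc) = linkC ℓ i := by
  revert i
  rw [constraints_iff hℓ]
  refine ⟨fun i => x.2.1 _, ?_⟩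
  rw [← norm_neg, ← smul_last, norm_smul, x.2.1, mul_one, Real.norm_of_nonneg (hℓ _).le]

/-- Dropping the last vector of a configuration. -/
def dropLast {d q : ℕ} {ℓ : Fin (q + 1) → ℝ} (hℓ : ∀ i, 0 < ℓ i) (x : ModuliM d ℓ) :
    level (d := d) (linkM ℓ) (linkC ℓ) :=
  ⟨Quotient.map (fun (x : Config d ℓ) i => x.1 i.castSucc)
    (by
      rintro _ _ ⟨A, hA, h⟩
      exact ⟨A, hA, fun i => h i.castSucc⟩) x, by
    induction x using Quotient.inductionOn
    exact constraints_of_config hℓ _⟩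

theorem dropLast_bijective {d q : ℕ} {ℓ : Fin (q + 1) → ℝ} (hℓ : ∀ i, 0 < ℓ i) :
    Function.Bijective (dropLast (d := d) hℓ) := by
  constructor
  · intro x x' h
    have h := congrArg Subtype.val h
    induction x using Quotient.inductionOn with | _ x => ?_
    induction x' using Quotient.inductionOn with | _ x' => ?_
    obtain ⟨A, hA, h⟩ := Quotient.exact h
    refine Quotient.sound ⟨A, hA, fun i => Fin.lastCases ?_ (fun i => h i) i⟩
    rw [last_eq hℓ x, last_eq hℓ x', act_smul, act_sum_smul]
    simp only [h]
  · rintro ⟨z, hz⟩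
    induction z using Quotient.inductionOn with | _ y => ?_
    obtain ⟨h1, h2⟩ := (constraints_iff hℓ).1 hz
    let x : Fin (q + 1) → E d :=
      Fin.snoc y (-(ℓ (Fin.last q))⁻¹ • ∑ i : Fin q, ℓ i.castSucc • y i)
    have hx : (∀ i, ‖x i‖ = 1) ∧ ∑ i, ℓ i • x i = 0 := by
      constructor
      · intro i
        refine Fin.lastCases ?_ (fun i => ?_) i
        · simp only [x, Fin.snoc_last]
          rw [norm_smul, h2, norm_neg, norm_inv, Real.norm_of_nonneg (hℓ _).le,
            inv_mul_cancel₀ (hℓ _).ne']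
        · simp only [x, Fin.snoc_castSucc]
          exact h1 i
      · rw [Fin.sum_univ_castSucc]
        simp only [x, Fin.snoc_last, Fin.snoc_castSucc]
        rw [smul_smul, mul_neg, mul_inv_cancel₀ (hℓ _).ne', neg_one_smul, add_neg_cancel]
    refine ⟨Quotient.mk _ ⟨x, hx⟩, Subtype.ext (congrArg (Quotient.mk _) ?_)⟩
    funext i
    simp [x]

theorem continuous_dropLast {d q : ℕ} {ℓ : Fin (q + 1) → ℝ} (hℓ : ∀ i, 0 < ℓ i) :
    Continuous (dropLast (d := d) hℓ) := by
  have h : Continuous fun (x : Config d ℓ) (i : Fin q) => x.1 i.castSucc :=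
    continuous_pi fun i => (continuous_apply _).comp continuous_subtype_val
  exact Continuous.subtype_mk
    (isQuotientMap_quotient_mk'.continuous_iff.2 ((isOpenQuotientMap_mk d q).continuous.comp h)) _

/-- The moduli space is the quotient cut out by the quadratic constraints. -/
def moduliHomeo {d q : ℕ} {ℓ : Fin (q + 1) → ℝ} (hℓ : ∀ i, 0 < ℓ i) :
    ModuliM d ℓ ≃ₜ level (d := d) (linkM ℓ) (linkC ℓ) :=
  Continuous.homeoOfEquivCompactToT2 (f := Equiv.ofBijective _ (dropLast_bijective hℓ))
    (continuous_dropLast hℓ)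

theorem vrank_moduliHomeo {d q : ℕ} {ℓ : Fin (q + 1) → ℝ} (hℓ : ∀ i, 0 < ℓ i) (x : ModuliM d ℓ) :
    vrank (moduliHomeo hℓ x).1 = rank x := by
  induction x using Quotient.inductionOn with | _ x => ?_
  rw [rank_mk]
  change trank (fun i => x.1 (Fin.castSucc i)) = _
  suffices h : Submodule.span ℝ (Set.range fun i : Fin q => x.1 i.castSucc) =
      Submodule.span ℝ (Set.range x.1) by rw [trank, trank, h]
  refine le_antisymm (Submodule.span_mono ?_) (Submodule.span_le.2 ?_)
  · rintro _ ⟨i, rfl⟩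
    exact ⟨_, rfl⟩
  · rintro _ ⟨i, rfl⟩
    refine Fin.lastCases ?_ (fun i => Submodule.subset_span ⟨i, rfl⟩) i
    rw [SetLike.mem_coe, last_eq hℓ x]
    exact Submodule.smul_mem _ _ (Submodule.sum_mem _ fun i _ =>
      Submodule.smul_mem _ _ (Submodule.subset_span ⟨i, rfl⟩))

/-- With Y = ∑ ℓ_j y_j, a relation reads g_i y_i = -(g ℓ_i) Y, where g belongs to the closing
constraint and Y ≠ 0. If g ≠ 0, every y_i is a multiple of Y and the rank is at most 1. If g = 0,
all g_i vanish because the y_i are unit vectors. -/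
theorem linearIndependent_linkM {d q : ℕ} {ℓ : Fin (q + 1) → ℝ} (hℓ : ∀ i, 0 < ℓ i)
    {y : Fin q → E d} (hy : ∀ i, qform (linkM ℓ i) y = linkC ℓ i) (h2 : 2 ≤ trank y) :
    LinearIndependent ℝ fun c i => ∑ j, linkM ℓ c i j • y j := by
  obtain ⟨hy1, hy2⟩ := (constraints_iff hℓ).1 hy
  have hY : ∑ i, ℓ (Fin.castSucc i) • y i ≠ 0 := by
    rw [← norm_ne_zero_iff, hy2]
    exact (hℓ _).ne'
  rw [Fintype.linearIndependent_iff]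
  intro g hg
  have hg' : ∀ i, g (some i) • y i = -(g none * ℓ i.castSucc) • ∑ i, ℓ (Fin.castSucc i) • y i :=
    fun i => by
      have := congrFun hg i
      rw [Fintype.sum_option, Pi.add_apply, Finset.sum_apply, Finset.sum_eq_single i] at this
      · simp only [linkM, Matrix.vecMulVec_apply, Pi.smul_apply, Pi.zero_apply] at this
        have e : ∑ j, (Matrix.single i i 1 : Matrix (Fin q) (Fin q) ℝ) i j • y j = y i := by
          rw [Finset.sum_eq_single i (fun j _ hj => by simp [hj.symm]) (by simp)]
          simp
        rw [e] at this
        rw [neg_smul, eq_neg_iff_add_eq_zero, ← this, add_comm]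
        simp [Finset.smul_sum, smul_smul, mul_assoc]
      · intro j _ hj
        simp [linkM, hj]
      · simp
  have h0 : g none = 0 := by
    by_contra h0
    have : Submodule.span ℝ (Set.range y) ≤
        Submodule.span ℝ {∑ i, ℓ (Fin.castSucc i) • y i} := by
      rw [Submodule.span_le]
      rintro _ ⟨i, rfl⟩
      have hgi : g (some i) ≠ 0 := fun h => by
        have := hg' i
        rw [h, zero_smul, eq_comm, smul_eq_zero, neg_eq_zero] at this
        exact this.elim (mul_ne_zero h0 (hℓ _).ne') hY
      have : y i = (g (some i))⁻¹ • g (some i) • y i := by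
        rw [smul_smul, inv_mul_cancel₀ hgi, one_smul]
      rw [SetLike.mem_coe, this, hg' i]
      exact Submodule.smul_mem _ _ (Submodule.smul_mem _ _ (Submodule.mem_span_singleton_self _))
    have := Submodule.finrank_mono this
    rw [finrank_span_singleton hY] at this
    rw [trank] at h2
    omega
  rintro (_ | i)
  · exact h0
  · have := hg' i
    rw [h0, zero_mul, neg_zero, zero_smul, smul_eq_zero] at this
    refine this.resolve_right fun h => ?_
    have := hy1 i
    rw [h, norm_zero] at this
    exact zero_ne_one this

/-- In rank at most one, x_i = c_i v with |c_i| |v| = 1, and closedness balances the lengths with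
c_i ≥ 0 against the others: a median subset. -/
theorem two_le_rank_of_generic {d q : ℕ} {ℓ : Fin (q + 1) → ℝ} (hg : Generic ℓ)
    (x : ModuliM d ℓ) : 2 ≤ rank x := by
  induction x using Quotient.inductionOn with | _ x => ?_
  rw [rank_mk]
  by_contra hlt
  obtain ⟨v, hv⟩ := finrank_le_one_iff.1 (show trank x.1 ≤ 1 by omega)
  have hc : ∀ i, ∃ c : ℝ, c • (v : E d) = x.1 i := fun i => by
    obtain ⟨c, hc⟩ := hv ⟨x.1 i, Submodule.subset_span ⟨i, rfl⟩⟩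
    exact ⟨c, congrArg Subtype.val hc⟩
  choose c hc using hc
  have hn : ∀ i, |c i| * ‖(v : E d)‖ = 1 := fun i => by
    have := x.2.1 i
    rwa [← hc i, norm_smul, Real.norm_eq_abs] at this
  have hv0 : ‖(v : E d)‖ ≠ 0 := right_ne_zero_of_mul (hn 0 ▸ one_ne_zero)
  have hs : ∑ i, ℓ i * c i = 0 := by
    have := x.2.2
    simp only [← hc, smul_smul, ← Finset.sum_smul] at this
    exact (smul_eq_zero.1 this).resolve_right (norm_ne_zero_iff.1 hv0)
  let J : Finset (Fin (q + 1)) := Finset.univ.filter fun i => 0 ≤ c i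
  have h1 : ∀ i ∈ J, ℓ i = ‖(v : E d)‖ * (ℓ i * c i) := fun i hi => by
    have := hn i
    rw [abs_of_nonneg (Finset.mem_filter.1 hi).2] at this
    linear_combination (-ℓ i) * this
  have h2 : ∀ i ∈ Jᶜ, ℓ i = -(‖(v : E d)‖ * (ℓ i * c i)) := fun i hi => by
    have := hn i
    have hneg : c i < 0 := by simpa [J] using hi
    rw [abs_of_neg hneg] at this
    linear_combination (-ℓ i) * this
  refine hg J ?_
  rw [Finset.sum_congr rfl h1, Finset.sum_congr rfl h2, Finset.sum_neg_distrib,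
    eq_neg_iff_add_eq_zero, Finset.sum_add_sum_compl, ← Finset.mul_sum, hs, mul_zero]

/-! ### Charts and filtration of the moduli space -/

theorem isClosedEmbedding_inclNM {m d q : ℕ} {ℓ : Fin (q + 1) → ℝ} (hℓ : ∀ i, 0 < ℓ i)
    (hmd : m < d) : IsClosedEmbedding (inclNM ℓ hmd) := by
  have : T2Space (ModuliM d ℓ) := (moduliHomeo hℓ).symm.t2Space
  exact (continuous_inclNM ℓ hmd).isClosedEmbedding (inclNM_injective ℓ hmd)

theorem exists_homeomorph_of_range_eq {X Y Z : Type*} [TopologicalSpace X] [TopologicalSpace Y]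
    [TopologicalSpace Z] {α : X → Z} {β : Y → Z} (hα : IsEmbedding α) (hβ : IsEmbedding β)
    (h : Set.range α = Set.range β) : ∃ ψ : X ≃ₜ Y, ∀ x, α x = β (ψ x) := by
  refine ⟨(hα.toHomeomorph.trans (Homeomorph.setCongr h)).trans hβ.toHomeomorph.symm, fun x => ?_⟩
  exact (congrArg Subtype.val
    (hβ.toHomeomorph.apply_symm_apply (Homeomorph.setCongr h (hα.toHomeomorph x)))).symm

/-- Near a point of rank `k ≥ 2`, the moduli space is a product of a Euclidean space with a
quotient `(ℝ^(d-k))^(n-1-k) / SO(d-k)`. -/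
theorem exists_chart_moduli {d q k : ℕ} {ℓ : Fin (q + 1) → ℝ} (hℓ : ∀ i, 0 < ℓ i)
    (h2 : 2 ≤ k) (hkd : k ≤ d) (hkq : k ≤ q) (x : ModuliM d ℓ) (hx : rank x = k) :
    ∃ χ : E (stratumDim (q + 1) k) × VecModSO (d - k) (q + 1 - 1 - k) → ModuliM d ℓ,
      IsOpenEmbedding χ ∧ x ∈ Set.range χ ∧ ∀ z, rank (χ z) = k + vrank z.2 := by
  obtain ⟨z, rfl⟩ := (moduliHomeo hℓ).symm.surjective x
  obtain ⟨z, hz⟩ := z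
  induction z using Quotient.inductionOn with | _ y => ?_
  have hy : trank y = k := by
    rw [← hx, ← vrank_moduliHomeo hℓ, Homeomorph.apply_symm_apply, vrank_mk]
  obtain ⟨Ψ, hΨ, h0, hr⟩ := exists_chart (C := Option (Fin q)) (d := d) (e := d - k)
    (r := q + 1 - 1 - k) (a := stratumDim (q + 1) k) (linkM_isSymm ℓ) (c := linkC ℓ)
    (by omega) (by omega) hy hz (linearIndependent_linkM hℓ hz (by omega))
    (by rw [bdim_eq_stratumDim h2 hkq]; simp)
  refine ⟨(moduliHomeo hℓ).symm ∘ Ψ, (moduliHomeo hℓ).symm.isOpenEmbedding.comp hΨ, ?_,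
    fun z => ?_⟩
  · exact ⟨_, congrArg (moduliHomeo hℓ).symm (Subtype.ext h0)⟩
  · rw [← vrank_moduliHomeo hℓ, Function.comp_apply, Homeomorph.apply_symm_apply, hr]

/-- The bound 2 ≤ m is absent from `rankFiltration`, but genericity forces it: a point of rank at
most m has rank at least 2. -/
theorem moduliFiltration_eq {d q : ℕ} {ℓ : Fin (q + 1) → ℝ} (hℓ : ∀ i, 0 < ℓ i) (hg : Generic ℓ)
    (hdq : d ≤ q) : moduliFiltration d ℓ = fun j => moduliHomeo hℓ ⁻¹'
      rankFiltration (moduliDim (q + 1) d) (Fintype.card (Option (Fin q)))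
        (level (d := d) (linkM ℓ) (linkC ℓ)) j := by
  funext j
  ext x
  simp only [moduliFiltration, rankFiltration, range_inclNM, Set.mem_preimage, Set.mem_ofPred_eq,
    vrank_moduliHomeo, Fintype.card_option, Fintype.card_fin]
  refine or_congr Iff.rfl (exists_congr fun m => ?_)
  constructor
  · rintro ⟨hm, h2, hj, hx⟩
    refine ⟨hm, ?_, hx⟩
    rw [bdim_eq_stratumDim h2 (by omega)]
    omega
  · rintro ⟨hm, hj, hx⟩
    have h2 := (two_le_rank_of_generic hg x).trans hx
    rw [bdim_eq_stratumDim h2 (by omega)] at hj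
    exact ⟨hm, h2, by omega, hx⟩

end Linkage

/-! ### The two assertions -/

theorem mainTheorem10 {n d : ℕ} (ℓ : Fin n → ℝ) (hℓ : ∀ i, 0 < ℓ i) :
    (∀ (k : ℕ) (x : Linkage.ModuliM d ℓ), 2 ≤ k → k < d - 1 → d - 1 ≤ n - 1 →
      Linkage.rank x = k →
      ∃ (U : Set (Linkage.ModuliM d ℓ))
        (φ : U ≃ₜ Linkage.E (Linkage.stratumDim n k) × Linkage.VecModSO (d - k) (n - 1 - k)),
        IsOpen U ∧ x ∈ U ∧
        ∀ (m : ℕ) (hkm : k ≤ m) (hmd : m + 2 ≤ d),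
          ∃ ψ : {y : Linkage.ModuliN m ℓ // Linkage.inclNM (d := d) ℓ (by omega) y ∈ U} ≃ₜ
              Linkage.E (Linkage.stratumDim n k) × Linkage.VecModO (m - k) (n - 1 - k),
            ∀ y, φ ⟨Linkage.inclNM (d := d) ℓ (by omega) y.1, y.2⟩ =
              ((ψ y).1, Linkage.vecIncl (n - 1 - k) (by omega) (ψ y).2)) ∧
    (2 ≤ d → d + 1 ≤ n → Linkage.Generic ℓ →
      Linkage.IsStratifiedPseudomanifold (Linkage.moduliDim n d) (Linkage.ModuliM d ℓ)
        (Linkage.moduliFiltration d ℓ)) := by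
  refine ⟨fun k x h2 hkd hdn hx => ?_, fun h2 hdn hg => ?_⟩
  · obtain ⟨q, rfl⟩ := Nat.exists_eq_add_of_le' (show 1 ≤ n by omega)
    obtain ⟨χ, hχ, hxU, hr⟩ := Linkage.exists_chart_moduli hℓ h2 (by omega) (by omega) x hx
    let φ := hχ.isEmbedding.toHomeomorph.symm
    have hφ : ∀ u, χ (φ u) = u := fun u =>
      congrArg Subtype.val (hχ.isEmbedding.toHomeomorph.apply_symm_apply u)
    refine ⟨Set.range χ, φ, hχ.isOpen_range, hxU, fun m hkm hmd => ?_⟩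
    have hm : m < d := by omega
    have hmk : m - k < d - k := by omega
    refine Linkage.exists_homeomorph_of_range_eq
      (α := fun y : {y : Linkage.ModuliN m ℓ // Linkage.inclNM ℓ hm y ∈ Set.range χ} =>
        φ ⟨Linkage.inclNM ℓ hm y.1, y.2⟩)
      (β := fun z : Linkage.E _ × Linkage.VecModO (m - k) (q + 1 - 1 - k) => (z.1, Linkage.vecIncl (q + 1 - 1 - k) hmk z.2)) ?_ ?_ ?_
    · exact φ.isEmbedding.comp
        ((Linkage.isClosedEmbedding_inclNM hℓ hm).isEmbedding.restrictPreimage (Set.range χ))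
    · exact Topology.IsEmbedding.id.prodMap
        (Linkage.isClosedEmbedding_vecIncl _ hmk).isEmbedding
    · ext z
      -- Both images are given by rank, and χ adds k: the transverse rank is at most m - k exactly
      -- when the total rank is at most m.
      have h1 : z.2 ∈ Set.range (Linkage.vecIncl (q + 1 - 1 - k) hmk) ↔
          χ z ∈ Set.range (Linkage.inclNM ℓ hm) := by
        rw [Linkage.range_vecIncl, Linkage.range_inclNM, Set.mem_ofPred_eq, Set.mem_ofPred_eq, hr]
        omega
      constructor
      · rintro ⟨y, rfl⟩
        obtain ⟨w, hw⟩ := h1.2 ⟨y.1, (hφ ⟨_, y.2⟩).symm⟩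
        exact ⟨(_, w), Prod.ext rfl hw⟩
      · rintro ⟨w, rfl⟩
        obtain ⟨y, hy⟩ := h1.1 ⟨w.2, rfl⟩
        refine ⟨⟨y, hy ▸ ⟨_, rfl⟩⟩, hχ.injective ?_⟩
        rw [hφ]
        exact hy
  · obtain ⟨q, rfl⟩ := Nat.exists_eq_add_of_le' (show 1 ≤ n by omega)
    have : CompactSpace (Linkage.level (d := d) (Linkage.linkM ℓ) (Linkage.linkC ℓ)) :=
      (Linkage.moduliHomeo hℓ).compactSpace
    have hreg : ∀ y : Fin q → Linkage.E d,
        (∀ i, Linkage.qform (Linkage.linkM ℓ i) y = Linkage.linkC ℓ i) → 2 ≤ Linkage.trank y ∧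
          LinearIndependent ℝ fun c i => ∑ j, Linkage.linkM ℓ c i j • y j := fun y hy => by
      have h := Linkage.two_le_rank_of_generic hg
        ((Linkage.moduliHomeo hℓ).symm ⟨Quotient.mk _ y, hy⟩)
      rw [← Linkage.vrank_moduliHomeo hℓ, Homeomorph.apply_symm_apply, Linkage.vrank_mk] at h
      exact ⟨h, Linkage.linearIndependent_linkM hℓ hy h⟩
    rw [Linkage.moduliFiltration_eq hℓ hg (by omega)]
    refine Linkage.IsStratifiedPseudomanifold.of_homeomorph
      (Linkage.isStratifiedPseudomanifold_level (k₀ := 2) (Linkage.linkM_isSymm ℓ) (by omega)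
        (by omega) hreg ?_ ?_) (Linkage.moduliHomeo hℓ)
    · rw [Linkage.bdim_eq_stratumDim le_rfl (by omega)]
      simp
    · rw [Linkage.bdim_eq_moduliDim h2 (by omega)]
      simp

end
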